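/- A graph of spaces $X$ consists of a set of connected vertex spaces, a set of connected edge spaces and, for every edge space $e$, two $\pi_1$-injective continuous edge maps $\partial_\pm$ from $e$ to the disjoint union of the vertex spaces. The associated topological space, also denoted $X$, is the quotient of $\bigsqcup V\sqcup\bigsqcup(e\times[-1,1])$ by $(x,\pm1)\sim\partial_\pm(x)$. A pre-covering $\bar X\to X$ is a locally injective map of graphs of spaces that sends vertex spaces to vertex spaces and edge spaces to edge spaces, commutes with the edge maps $\partial_\pm$, and restricts to a covering on each vertex space and on each edge space. A pre-covering or covering is finite-sheeted if every point has finitely many preimages; the fibres of a covering are non-empty. Let $X$ be a graph of spaces with finitely many edge spaces, each of which is a circle, and whose vertex spaces are connected, locally path-connected and semilocally simply connected (for instance connected complexes). Suppose that for every edge space $e$ the image of $H_1(e,\mathbb Z)\to H_1(X,\mathbb Z)$ is an infinite direct factor of $H_1(X,\mathbb Z)$. Let $\bar X\to X$ be a finite-sheeted pre-covering, and suppose that either (1) $X$ has exactly one vertex space, or (2) $X$ has exactly two vertex spaces and $\bar X$ is connected. Then there exist finite-sheeted coverings $\hat X\to\bar X$ and $\tilde X\to X$ and a topological embedding $\hat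 X\hookrightarrow\tilde X$ such that the square $$\begin{array}{ccc}\hat X&\hookrightarrow&\tilde X\\ \downarrow&&\downarrow\\ \bar X&\to&X\end{array}$$ commutes. -/

import Mathlib

universe u

/-- A space is semilocally simply connected if every point has a neighbourhood all of whose loops
at that point are null-homotopic in the whole space. -/
class SemilocallySimplyConnected (X : Type*) [TopologicalSpace X] : Prop where
  exists_nhds : ∀ x : X, ∃ U ∈ nhds x, ∀ γ : Path x x,
    Set.range γ ⊆ U → Path.Homotopic γ (Path.refl x)

/-- A graph of spaces: a set `V` of connected vertex spaces, a set `E` of connected edge spaces and,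
for each edge space `e`, a pair of `π₁`-injective continuous edge maps `∂₊`, `∂₋` from `e` to the
disjoint union of the vertex spaces (`bd e true` is `∂₊` and `bd e false` is `∂₋`). -/
structure GraphOfSpaces where
  V : Type u
  E : Type u
  vert : V → Type u
  edge : E → Type u
  [topVert : ∀ v, TopologicalSpace (vert v)]
  [topEdge : ∀ e, TopologicalSpace (edge e)]
  [connectedVert : ∀ v, ConnectedSpace (vert v)]
  [connectedEdge : ∀ e, ConnectedSpace (edge e)]
  bd : ∀ e : E, Bool → C(edge e, Σ v : V, vert v)
  bd_injective : ∀ (e : E) (s : Bool) (x : edge e),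
    Function.Injective (FundamentalGroup.map (bd e s) x)

namespace GraphOfSpaces

attribute [instance] topVert topEdge connectedVert connectedEdge

/-- The endpoint `+1` (for `true`) or `-1` (for `false`) of the interval `[-1, +1]`. -/
def endpt : Bool → Set.Icc (-1 : ℝ) 1
  | true => ⟨1, by norm_num, le_rfl⟩
  | false => ⟨-1, le_rfl, by norm_num⟩

/-- The disjoint union of the vertex spaces and of the cylinders `e × [-1, +1]`. -/
abbrev Pieces (X : GraphOfSpaces.{u}) : Type u :=
  (Σ v : X.V, X.vert v) ⊕ (Σ e : X.E, X.edge e × Set.Icc (-1 : ℝ) 1)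

/-- The gluing relation: `(x, ±1)` is identified with `∂_± x`. -/
inductive Glue (X : GraphOfSpaces.{u}) : X.Pieces → X.Pieces → Prop
  | mk (e : X.E) (s : Bool) (x : X.edge e) :
      Glue X (Sum.inr ⟨e, (x, endpt s)⟩) (Sum.inl (X.bd e s x))

/-- The topological space associated to a graph of spaces, with the quotient topology. -/
def Realization (X : GraphOfSpaces.{u}) : Type u := Quot (Glue X)

instance (X : GraphOfSpaces.{u}) : TopologicalSpace X.Realization :=
  inferInstanceAs (TopologicalSpace (Quot (Glue X)))

/-- The inclusion of an edge space `e` as `e × {0}` in the associated topological space. -/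
def edgeIncl (X : GraphOfSpaces.{u}) (e : X.E) : C(X.edge e, X.Realization) where
  toFun x := Quot.mk _ (Sum.inr ⟨e, (x, ⟨0, by norm_num, by norm_num⟩)⟩)
  continuous_toFun := by
    refine continuous_quot_mk.comp (continuous_inr.comp (continuous_sigmaMk.comp ?_))
    exact continuous_id.prodMk continuous_const

/-- A morphism of graphs of spaces sending vertex spaces to vertex spaces and edge spaces to edge
spaces, for which the squares of edge maps commute. -/
structure Hom (Y X : GraphOfSpaces.{u}) where
  onV : Y.V → X.V
  onE : Y.E → X.E
  vertMap : ∀ v : Y.V, C(Y.vert v, X.vert (onV v))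
  edgeMap : ∀ e : Y.E, C(Y.edge e, X.edge (onE e))
  comm : ∀ (e : Y.E) (s : Bool) (x : Y.edge e),
    Sigma.map onV (fun v => vertMap v) (Y.bd e s x) = X.bd (onE e) s (edgeMap e x)

/-- The map induced on pieces: `vertMap` on vertex spaces, `edgeMap × id` on cylinders. -/
def Hom.onPieces {Y X : GraphOfSpaces.{u}} (f : Hom Y X) : Y.Pieces → X.Pieces :=
  Sum.map (Sigma.map f.onV fun v => f.vertMap v)
    (Sigma.map f.onE fun e => Prod.map (f.edgeMap e) id)

/-- The map induced by a morphism on the associated topological spaces. -/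
def Hom.toMap {Y X : GraphOfSpaces.{u}} (f : Hom Y X) : Y.Realization → X.Realization :=
  Quot.map f.onPieces (by
    rintro _ _ ⟨e, s, x⟩
    have h := Glue.mk (f.onE e) s (f.edgeMap e x)
    rw [← f.comm] at h
    exact h)

/-- A pre-covering: a locally injective map that restricts to a covering on each vertex space and
on each edge space. -/
structure Hom.IsPreCovering {Y X : GraphOfSpaces.{u}} (f : Hom Y X) : Prop where
  vert_covering : ∀ v, IsCoveringMap (f.vertMap v)
  edge_covering : ∀ e, IsCoveringMap (f.edgeMap e)
  locallyInjective : IsLocallyInjective f.toMap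

end GraphOfSpaces

/-- Every point has finitely many preimages. -/
def FiniteSheeted {A B : Type*} (p : A → B) : Prop := ∀ b, (p ⁻¹' {b}).Finite

/-- A finite-sheeted covering; every point of the base has a non-empty, finite fibre. -/
structure IsFiniteSheetedCovering {A B : Type*} [TopologicalSpace A] [TopologicalSpace B]
    (p : A → B) : Prop where
  isCoveringMap : IsCoveringMap p
  surjective : Function.Surjective p
  finiteSheeted : FiniteSheeted p

/-- The first singular homology group with integer coefficients, as a functor. -/
noncomputable def singularH1 : CategoryTheory.Functor TopCat.{u} AddCommGrpCat.{u} :=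
  (AlgebraicTopology.singularHomologyFunctor AddCommGrpCat.{u} 1).obj
    (AddCommGrpCat.of (ULift.{u} ℤ))

/-- The homomorphism induced by a continuous map on first singular homology. -/
noncomputable def singularH1Map {A B : Type u} [TopologicalSpace A] [TopologicalSpace B]
    (i : C(A, B)) : singularH1.obj (TopCat.of A) →+ singularH1.obj (TopCat.of B) :=
  (singularH1.map (TopCat.ofHom i)).hom

/-- The image of `φ` is an infinite direct factor of the abelian group `H`. -/
def IsInfiniteDirectFactor {G H : Type*} [AddCommGroup G] [AddCommGroup H] (φ : G →+ H) : Prop :=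
  Infinite φ.range ∧ ∃ C : AddSubgroup H, IsCompl φ.range C

/-! Completing a pre-covering to a covering is a matching problem over the edge circles. Adding
trivial sheets turns the vertex part of the pre-covering into a covering `W` of the vertex spaces of
constant degree n. The two edge maps pull `W` back to two n-sheeted coverings of each circle. To
glue in cylinders one needs an isomorphism between the two that extends the partial one prescribed
by the given edge spaces. In general there is none, since the cycle types of the two monodromies may
differ.

The homological hypothesis removes this obstruction. The class of an edge circle generates an
infinite direct factor, so some homomorphism from H₁(X) to ℤ sends it to 1. Reducing modulo n! and
taking the product over all edges gives a class with values in the finite group A = (ℤ/n!)^E whose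
value on every edge circle has order exactly n!. It defines a principal A-covering P of the vertex
spaces. The monodromy of `W` around a circle permutes n points, so its n!-th power is trivial. Hence
on the fibre product of `W` and P all monodromy cycles have length exactly n!, at both ends of every
edge. A finite covering of a circle of this kind is determined by its degree, and a partial
isomorphism extends because what remains on the two sides has equally many cycles.

Because the class lives on all of X, integrating it across a cylinder (`crossing`) identifies the
pullbacks of P to the two ends of an edge. So P pulls back to a finite covering of the pre-covering,
which sits inside the fibre product and prescribes the partial isomorphism to be extended.

The class is handled as a `PathCocycle`, obtained from homology in
`exists_pathCocycle_of_isInfiniteDirectFactor`; `PathCocycle.IsAdapted.coord_sub` computes the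
monodromy of P; `Equiv.Perm.exists_conj_extending` and `exists_homeomorph_extending` extend
isomorphisms; `DoubleCylinder.isCoveringMap_map` recognizes glued coverings. These meet in
`DoubleCylinder.exists_finite_covering_extending`. -/

open Topology unitInterval

/-! ### Coverings through explicit sheets; pullbacks, fibre products, disjoint unions. -/

section Sheets

variable {E E' B B' : Type*} [TopologicalSpace E] [TopologicalSpace E'] [TopologicalSpace B]
  [TopologicalSpace B']

/-- The sets `O s` are the sheets of `p` over the open set `U`. -/
structure IsSheets (p : E → B) (U : Set B) {S : Type*} (O : S → Set E) : Prop where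
  isOpen_base : IsOpen U
  isOpen : ∀ s, IsOpen (O s)
  mem_base : ∀ s, ∀ z ∈ O s, p z ∈ U
  exists_lift : ∀ s, ∀ b ∈ U, ∃ z ∈ O s, p z = b
  inj : ∀ s, ∀ z ∈ O s, ∀ z' ∈ O s, p z = p z' → z = z'
  cover : ∀ z, p z ∈ U → ∃ s, z ∈ O s
  disj : ∀ z s t, z ∈ O s → z ∈ O t → s = t

theorem IsSheets.mono {p : E → B} {U : Set B} {S : Type*} {O : S → Set E} (h : IsSheets p U O)
    (hp : Continuous p) {U' : Set B} (hU' : IsOpen U') (hUU' : U' ⊆ U) :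
    IsSheets p U' fun s => O s ∩ p ⁻¹' U' where
  isOpen_base := hU'
  isOpen s := (h.isOpen s).inter (hU'.preimage hp)
  mem_base s z hz := hz.2
  exists_lift s b hb := by
    obtain ⟨z, hz, rfl⟩ := h.exists_lift s b (hUU' hb)
    exact ⟨z, ⟨hz, hb⟩, rfl⟩
  inj s z hz z' hz' := h.inj s z hz.1 z' hz'.1
  cover z hz := by
    obtain ⟨s, hs⟩ := h.cover z (hUU' hz)
    exact ⟨s, hs, hz⟩
  disj z s t hs ht := h.disj z s t hs.1 ht.1

/-- The sheet through a point is a locally constant function, as the sheets are open and disjoint.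
Together with `p` it is the trivialization, and its inverse is continuous because `p` is open. -/
theorem isCoveringMap_of_isSheets {p : E → B} (hc : Continuous p) (ho : IsOpenMap p)
    (h : ∀ b, ∃ (U : Set B) (S : Type*) (O : S → Set E), b ∈ U ∧ IsSheets p U O) :
    IsCoveringMap p := by
  intro b
  obtain ⟨U, S, O, hb, hO⟩ := h b
  let _ : TopologicalSpace S := ⊥
  have : DiscreteTopology S := ⟨rfl⟩
  refine IsEvenlyCovered.to_isEvenlyCovered_preimage (?_ : IsEvenlyCovered p b S)
  refine ⟨inferInstance, U, hb, hO.isOpen_base, hO.isOpen_base.preimage hc, ?_⟩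
  choose τ hτ using fun z : p ⁻¹' U => hO.cover z.1 z.2
  choose ψ hψ hψp using fun x : U × S => hO.exists_lift x.2 x.1 x.1.2
  have hτc : Continuous τ := by
    rw [continuous_discrete_rng]
    intro s
    have : τ ⁻¹' {s} = Subtype.val ⁻¹' (O s) := by
      ext z
      exact ⟨fun h => by rw [← show τ z = s from h]; exact hτ z, fun h => hO.disj _ _ _ (hτ z) h⟩
    rw [this]
    exact (hO.isOpen s).preimage continuous_subtype_val
  let e : p ⁻¹' U ≃ U × S :=
    { toFun := fun z => (⟨p z, z.2⟩, τ z)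
      invFun := fun x => ⟨ψ x, by rw [Set.mem_preimage, hψp]; exact x.1.2⟩
      left_inv := fun z => Subtype.ext (hO.inj _ _ (hψ _) _ (hτ z) (hψp _))
      right_inv := fun x => Prod.ext (Subtype.ext (hψp x)) (hO.disj _ _ _ (hτ _) (hψ x)) }
  have hec : Continuous e := by
    refine Continuous.prodMk (Continuous.subtype_mk (hc.comp continuous_subtype_val) _) hτc
  have heo : IsOpenMap e := by
    intro G hG
    obtain ⟨G', hG', rfl⟩ := isOpen_induced_iff.1 hG
    have : e '' (Subtype.val ⁻¹' G') = ⋃ s : S, (Subtype.val ⁻¹' (p '' (G' ∩ O s))) ×ˢ {s} := by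
      ext ⟨x, s⟩
      simp only [Set.mem_image, Set.mem_iUnion, Set.mem_prod, Set.mem_preimage, Set.mem_singleton_iff]
      constructor
      · rintro ⟨z, hz, hzx⟩
        refine ⟨s, ⟨z, ⟨hz, ?_⟩, ?_⟩, rfl⟩
        · rw [← show τ z = s from congrArg Prod.snd hzx]; exact hτ z
        · exact congrArg (fun q => (Prod.fst q).1) hzx
      · rintro ⟨_, ⟨z, ⟨hz, hzO⟩, hzx⟩, rfl⟩
        have hzU : p z ∈ U := hO.mem_base _ _ hzO
        exact ⟨⟨z, hzU⟩, hz, Prod.ext (Subtype.ext hzx) (hO.disj _ _ _ (hτ _) hzO)⟩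
    rw [this]
    exact isOpen_iUnion fun s => ((ho _ (hG'.inter (hO.isOpen s))).preimage
      continuous_subtype_val).prod (isOpen_discrete _)
  exact ⟨e.toHomeomorphOfContinuousOpen hec heo, fun z => rfl⟩

theorem IsCoveringMap.exists_isSheets {p : E → B} (hp : IsCoveringMap p) (b : B) :
    ∃ (U : Set B) (O : p ⁻¹' {b} → Set E), b ∈ U ∧ IsSheets p U O := by
  obtain ⟨hd, U, hb, hU, hpU, H, hH⟩ := hp b
  refine ⟨U, fun s => Subtype.val '' (H ⁻¹' {x | x.2 = s}), hb, hU, fun s => ?_, ?_, ?_, ?_, ?_, ?_⟩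
  · refine (hpU.isOpenMap_subtype_val) _ (IsOpen.preimage H.continuous ?_)
    exact (isOpen_discrete {s}).preimage continuous_snd
  · rintro s _ ⟨z, -, rfl⟩
    exact z.2
  · intro s b hb
    exact ⟨(H.symm (⟨b, hb⟩, s)).1, ⟨_, by simp, rfl⟩, by rw [← hH]; simp⟩
  · rintro s _ ⟨z, hz, rfl⟩ _ ⟨z', hz', rfl⟩ h
    congr 1
    refine H.injective (Prod.ext (Subtype.ext ?_) (hz.trans hz'.symm))
    rw [hH, hH, h]
  · intro z hz
    exact ⟨(H ⟨z, hz⟩).2, ⟨z, hz⟩, rfl, rfl⟩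
  · rintro _ s t ⟨z, hz, rfl⟩ ⟨z', hz', h⟩
    rw [Subtype.val_injective h] at hz'
    exact hz.symm.trans hz'

theorem IsSheets.nonempty_equiv_fiber {p : E → B} {U : Set B} {S : Type*} {O : S → Set E}
    (h : IsSheets p U O) {b : B} (hb : b ∈ U) : Nonempty (S ≃ p ⁻¹' {b}) := by
  choose ψ hψ hψp using fun s => h.exists_lift s b hb
  refine ⟨Equiv.ofBijective (fun s => ⟨ψ s, hψp s⟩) ⟨fun s t hst => ?_, fun z => ?_⟩⟩
  · have : ψ s = ψ t := congrArg Subtype.val hst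
    exact h.disj (ψ s) _ _ (hψ s) (this ▸ hψ t)
  · obtain ⟨s, hs⟩ := h.cover z.1 (by rw [show p z.1 = b from z.2]; exact hb)
    exact ⟨s, Subtype.ext (h.inj s _ (hψ s) _ hs ((hψp s).trans z.2.symm))⟩

theorem IsCoveringMap.isLocallyConstant_card_fiber {p : E → B} (hp : IsCoveringMap p) :
    IsLocallyConstant fun b => Nat.card (p ⁻¹' {b}) := by
  rw [IsLocallyConstant.iff_exists_open]
  intro b
  obtain ⟨U, O, hb, hO⟩ := hp.exists_isSheets b
  refine ⟨U, hO.isOpen_base, hb, fun b' hb' => ?_⟩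
  obtain ⟨e⟩ := hO.nonempty_equiv_fiber hb
  obtain ⟨e'⟩ := hO.nonempty_equiv_fiber hb'
  exact Nat.card_congr (e'.symm.trans e)

/-- The image is clopen: sheets near `b` are indexed by the fibre over `b`, so an empty fibre stays
empty nearby. -/
theorem IsCoveringMap.surjective_of_connected {p : E → B} (hp : IsCoveringMap p) [Nonempty E]
    [PreconnectedSpace B] : Function.Surjective p := by
  have hcl : IsClopen (Set.range p) := by
    refine ⟨⟨?_⟩, hp.isOpenMap.isOpen_range⟩
    rw [isOpen_iff_forall_mem_open]
    intro b hb
    obtain ⟨U, O, hbU, hO⟩ := hp.exists_isSheets b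
    refine ⟨U, ?_, hO.isOpen_base, hbU⟩
    rintro _ hx ⟨z, rfl⟩
    obtain ⟨s, -⟩ := hO.cover z hx
    exact hb ⟨s.1, s.2⟩
  exact Set.range_eq_univ.1 (hcl.eq_univ (Set.range_nonempty p))

theorem isOpenMap_pullback_snd {p : E → B} (ho : IsOpenMap p) {g : B' → B} (hg : Continuous g) :
    IsOpenMap (fun z : Function.Pullback p g => z.1.2) := by
  intro G hG
  obtain ⟨G', hG', rfl⟩ := isOpen_induced_iff.1 hG
  rw [isOpen_iff_forall_mem_open]
  rintro _ ⟨⟨⟨z, b⟩, hzb⟩, hz, rfl⟩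
  obtain ⟨M, N, hM, hN, hzM, hbN, hMN⟩ := isOpen_prod_iff.1 hG' z b hz
  refine ⟨N ∩ g ⁻¹' (p '' M), ?_, hN.inter ((ho M hM).preimage hg), hbN, z, hzM, hzb⟩
  rintro b' ⟨hb', z', hz', hzz⟩
  exact ⟨⟨(z', b'), hzz⟩, hMN ⟨hz', hb'⟩, rfl⟩

theorem IsCoveringMap.pullback_snd {p : E → B} (hp : IsCoveringMap p) {g : B' → B}
    (hg : Continuous g) : IsCoveringMap (fun z : Function.Pullback p g => z.1.2) := by
  refine isCoveringMap_of_isSheets (by fun_prop) (isOpenMap_pullback_snd hp.isOpenMap hg) fun b => ?_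
  obtain ⟨U, O, hb, hO⟩ := hp.exists_isSheets (g b)
  refine ⟨g ⁻¹' U, _, fun s => (fun z : Function.Pullback p g => z.1.1) ⁻¹' O s, hb,
    hO.isOpen_base.preimage hg, fun s => (hO.isOpen s).preimage (by fun_prop), ?_, ?_, ?_, ?_, ?_⟩
  · intro s z hz
    rw [Set.mem_preimage, ← z.2]
    exact hO.mem_base s _ hz
  · intro s b hb
    obtain ⟨z, hz, hzb⟩ := hO.exists_lift s _ hb
    exact ⟨⟨(z, b), hzb⟩, hz, rfl⟩
  · intro s z hz z' hz' h
    refine Subtype.ext (Prod.ext (hO.inj s _ hz _ hz' ?_) h)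
    rw [z.2, z'.2, h]
  · intro z hz
    exact hO.cover z.1.1 (by rw [z.2]; exact hz)
  · intro z s t hs ht
    exact hO.disj _ _ _ hs ht

theorem IsCoveringMap.pullback_fst {p : E → B} (hp : IsCoveringMap p) {g : B' → B}
    (hg : Continuous g) : IsCoveringMap (fun z : Function.Pullback g p => z.1.1) := by
  let e : Function.Pullback g p ≃ₜ Function.Pullback p g :=
    { toFun := fun z => ⟨(z.1.2, z.1.1), z.2.symm⟩
      invFun := fun z => ⟨(z.1.2, z.1.1), z.2.symm⟩
      left_inv := fun z => rfl
      right_inv := fun z => rfl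
      continuous_toFun := by fun_prop
      continuous_invFun := by fun_prop }
  exact (hp.pullback_snd hg).comp_homeomorph e

theorem IsCoveringMap.fiberProduct {p : E → B} (hp : IsCoveringMap p) {q : E' → B}
    (hq : IsCoveringMap q) : IsCoveringMap (fun z : Function.Pullback p q => p z.1.1) := by
  have hpc := hp.continuous
  have hqc := hq.continuous
  have heq : (fun z : Function.Pullback p q => p z.1.1) = q ∘ fun z => z.1.2 := funext fun z => z.2
  refine isCoveringMap_of_isSheets (by fun_prop) ?_ fun b => ?_
  · rw [heq]
    exact hq.isOpenMap.comp (isOpenMap_pullback_snd hp.isOpenMap hqc)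
  obtain ⟨U, O, hb, hO⟩ := hp.exists_isSheets b
  obtain ⟨U', O', hb', hO'⟩ := hq.exists_isSheets b
  refine ⟨U ∩ U', p ⁻¹' {b} × q ⁻¹' {b}, fun s => {z | z.1.1 ∈ O s.1 ∧ z.1.2 ∈ O' s.2}, ⟨hb, hb'⟩,
    hO.isOpen_base.inter hO'.isOpen_base, fun s => ?_, ?_, ?_, ?_, ?_, ?_⟩
  · exact ((hO.isOpen s.1).preimage (by fun_prop : Continuous fun z : Function.Pullback p q => z.1.1)).inter
      ((hO'.isOpen s.2).preimage (by fun_prop : Continuous fun z : Function.Pullback p q => z.1.2))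
  · rintro s z ⟨h1, h2⟩
    exact ⟨hO.mem_base _ _ h1, by rw [z.2]; exact hO'.mem_base _ _ h2⟩
  · rintro s b ⟨h1, h2⟩
    obtain ⟨z, hz, hzb⟩ := hO.exists_lift s.1 _ h1
    obtain ⟨z', hz', hzb'⟩ := hO'.exists_lift s.2 _ h2
    exact ⟨⟨(z, z'), hzb.trans hzb'.symm⟩, ⟨hz, hz'⟩, hzb⟩
  · rintro s z ⟨hz1, hz2⟩ z' ⟨hz1', hz2'⟩ h
    refine Subtype.ext (Prod.ext (hO.inj s.1 _ hz1 _ hz1' h) (hO'.inj s.2 _ hz2 _ hz2' ?_))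
    rw [← z.2, ← z'.2]; exact h
  · rintro z ⟨h1, h2⟩
    obtain ⟨s, hs⟩ := hO.cover _ h1
    obtain ⟨t, ht⟩ := hO'.cover z.1.2 (by rw [← z.2]; exact h2)
    exact ⟨(s, t), hs, ht⟩
  · rintro z s t ⟨h1, h2⟩ ⟨h3, h4⟩
    exact Prod.ext (hO.disj _ _ _ h1 h3) (hO'.disj _ _ _ h2 h4)

/-- A covering over each summand, with finitely many components over each component of the base. -/
theorem isCoveringMap_sigmaMap {ι κ : Type*} {F : ι → Type*} {C : κ → Type*}
    [∀ i, TopologicalSpace (F i)] [∀ k, TopologicalSpace (C k)] [∀ k, PreconnectedSpace (C k)]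
    [∀ i, Nonempty (F i)] (o : ι → κ) (p : ∀ i, F i → C (o i)) (hp : ∀ i, IsCoveringMap (p i))
    (hfin : ∀ b, ((Sigma.map o p) ⁻¹' {b}).Finite) : IsCoveringMap (Sigma.map o p) := by
  have hc : Continuous (Sigma.map o p) := Continuous.sigma_map fun i => (hp i).continuous
  have ho : IsOpenMap (Sigma.map o p) := by
    rw [isOpenMap_sigma]
    exact fun i => (isOpenMap_sigmaMk).comp (hp i).isOpenMap
  refine isCoveringMap_of_isSheets hc ho ?_
  rintro ⟨k, x⟩
  have hsurj := fun i => (hp i).surjective_of_connected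
  -- Each summand over `C k` surjects onto it and so contributes a point to the finite fibre. This
  -- finiteness is what allows the evenly covered sets of the summands to be intersected below.
  have hfk : Finite {i // o i = k} := by
    have := (hfin ⟨k, x⟩).to_subtype
    have : ∀ i : {i // o i = k}, ∃ z : F i, Sigma.map o p ⟨i, z⟩ = ⟨k, x⟩ := by
      rintro ⟨i, rfl⟩
      obtain ⟨z, hz⟩ := hsurj i x
      exact ⟨z, by simp [Sigma.map, hz]⟩
    choose z hz using this
    refine Finite.of_injective (fun i => (⟨⟨i, z i⟩, hz i⟩ : (Sigma.map o p) ⁻¹' {⟨k, x⟩})) ?_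
    intro i j hij
    exact Subtype.ext (congrArg (fun w => w.1.1) hij)
  have hloc : ∀ i : {i // o i = k}, ∃ (U : Set (C k)) (S : Type _) (O : S → Set (F i)),
      x ∈ U ∧ IsOpen U ∧ IsSheets (p i) {y | ∃ u ∈ U, (⟨o i, y⟩ : Σ k, C k) = ⟨k, u⟩} O := by
    rintro ⟨i, rfl⟩
    obtain ⟨U, O, hx, hO⟩ := (hp i).exists_isSheets x
    refine ⟨U, _, O, hx, hO.isOpen_base, ?_⟩
    convert hO
    ext y
    simp
  choose U S O hx hU hO using hloc
  have hUo : IsOpen (⋂ i, U i) := isOpen_iInter_of_finite hU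
  have hbase : IsOpen (Sigma.mk k '' (⋂ i, U i)) := isOpenMap_sigmaMk _ hUo
  refine ⟨Sigma.mk k '' (⋂ i, U i), Σ i, S i, fun s => (Sigma.mk s.1.1 '' (O s.1 s.2)) ∩
    (Sigma.map o p) ⁻¹' (Sigma.mk k '' (⋂ i, U i)), ⟨x, by simpa using fun a b => hx ⟨a, b⟩, rfl⟩, hbase, ?_, ?_, ?_, ?_, ?_, ?_⟩
  · intro s
    exact (isOpenMap_sigmaMk _ ((hO s.1).isOpen s.2)).inter (hbase.preimage hc)
  · exact fun s z hz => hz.2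
  · rintro ⟨⟨i, rfl⟩, s⟩ _ ⟨y, hy, rfl⟩
    obtain ⟨z, hz, hzy⟩ := (hO ⟨i, rfl⟩).exists_lift s y ⟨y, Set.mem_iInter.1 hy _, rfl⟩
    exact ⟨⟨i, z⟩, ⟨⟨z, hz, rfl⟩, y, hy, by simp [Sigma.map, hzy]⟩, by simp [Sigma.map, hzy]⟩
  · rintro ⟨⟨i, rfl⟩, s⟩ _ ⟨⟨z, hz, rfl⟩, -⟩ _ ⟨⟨z', hz', rfl⟩, -⟩ h
    have : p i z = p i z' := by simpa [Sigma.map] using h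
    rw [(hO ⟨i, rfl⟩).inj s z hz z' hz' this]
  · rintro ⟨i, z⟩ ⟨y, hy, hyz⟩
    obtain rfl : k = o i := congrArg Sigma.fst hyz
    have : y = p i z := by simpa [Sigma.map] using hyz
    subst this
    obtain ⟨s, hs⟩ := (hO ⟨i, rfl⟩).cover z ⟨p i z, Set.mem_iInter.1 hy _, rfl⟩
    exact ⟨⟨⟨i, rfl⟩, s⟩, ⟨z, hs, rfl⟩, p i z, hy, rfl⟩
  · rintro ⟨i, z⟩ ⟨⟨j, hj⟩, s⟩ ⟨⟨j', hj'⟩, t⟩ ⟨⟨z1, hz1, h1⟩, -⟩ ⟨⟨z2, hz2, h2⟩, -⟩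
    obtain rfl : j = i := congrArg Sigma.fst h1
    obtain rfl : j' = j := congrArg Sigma.fst h2
    obtain rfl : z1 = z := by simpa using h1
    obtain rfl : z2 = z1 := by simpa using h2
    rw [(hO _).disj z2 s t hz1 hz2]

/-- A map into a covering space is continuous if its projection is and it respects sheets. -/
theorem continuousAt_of_isSheets {T : Type*} [TopologicalSpace T] {p : E → B} (ho : IsOpenMap p)
    {U : Set B} {S : Type*} {O : S → Set E} (hO : IsSheets p U O) {f : T → E} {t : T}
    (hpf : ContinuousAt (p ∘ f) t) {s : S} (hs : ∀ᶠ t' in 𝓝 t, f t' ∈ O s) : ContinuousAt f t := by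
  intro G hG
  change f ⁻¹' G ∈ 𝓝 t
  have hft : f t ∈ O s := hs.self_of_nhds
  have h1 : p '' (G ∩ O s) ∈ 𝓝 (p (f t)) :=
    ho.image_mem_nhds (Filter.inter_mem hG ((hO.isOpen s).mem_nhds hft))
  filter_upwards [hpf.preimage_mem_nhds h1, hs] with t' ⟨z, hz, hzt⟩ ht'
  have : z = f t' := hO.inj s _ hz.2 _ ht' hzt
  exact Set.mem_preimage.2 (this ▸ hz.1)

end Sheets

namespace GraphOfSpaces

theorem endpt_injective : Function.Injective endpt := by
  intro s t h
  have := congrArg Subtype.val h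
  cases s <;> cases t <;> simp [endpt] at this ⊢ <;> norm_num at this

end GraphOfSpaces

open GraphOfSpaces

/-- The interval `[-1, 1]`. -/
abbrev SignedInterval : Type := Set.Icc (-1 : ℝ) 1

/-! ### Double mapping cylinders and the maps between them. -/

section DoubleMappingCylinder

variable {V E : Type u} [TopologicalSpace V] [TopologicalSpace E]

/-- The relation identifying `(x, ±1)` with `d ± x`. -/
inductive CylinderGlue (d : Bool → C(E, V)) : V ⊕ E × SignedInterval → V ⊕ E × SignedInterval → Prop
  | mk (s : Bool) (x : E) : CylinderGlue d (Sum.inr (x, endpt s)) (Sum.inl (d s x))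

/-- The double mapping cylinder of two maps `d ±` from `E` to `V`. -/
def DoubleCylinder (d : Bool → C(E, V)) : Type u := Quot (CylinderGlue d)

namespace DoubleCylinder

variable {d : Bool → C(E, V)}

instance : TopologicalSpace (DoubleCylinder d) :=
  inferInstanceAs (TopologicalSpace (Quot (CylinderGlue d)))

/-- The inclusion of the vertex space. -/
def vert (d : Bool → C(E, V)) (v : V) : DoubleCylinder d := Quot.mk _ (Sum.inl v)

/-- The quotient map on the cylinder. -/
def cyl (d : Bool → C(E, V)) (x : E × SignedInterval) : DoubleCylinder d := Quot.mk _ (Sum.inr x)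

@[fun_prop]
theorem continuous_vert : Continuous (vert d) := continuous_quot_mk.comp continuous_inl

@[fun_prop]
theorem continuous_cyl : Continuous (cyl d) := continuous_quot_mk.comp continuous_inr

theorem cyl_endpt (s : Bool) (x : E) : cyl d (x, endpt s) = vert d (d s x) :=
  Quot.sound (CylinderGlue.mk s x)

theorem isOpen_iff {G : Set (DoubleCylinder d)} :
    IsOpen G ↔ IsOpen (vert d ⁻¹' G) ∧ IsOpen (cyl d ⁻¹' G) := by
  have h : IsOpen (Quot.mk (CylinderGlue d) ⁻¹' G) ↔ IsOpen G :=
    (isQuotientMap_quot_mk (r := CylinderGlue d)).isOpen_preimage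
  rw [← h, isOpen_sum_iff]
  rfl

theorem isClosed_iff {G : Set (DoubleCylinder d)} :
    IsClosed G ↔ IsClosed (vert d ⁻¹' G) ∧ IsClosed (cyl d ⁻¹' G) := by
  rw [← isOpen_compl_iff, isOpen_iff, ← isOpen_compl_iff, ← isOpen_compl_iff]
  rfl

theorem continuous_iff {T : Type*} [TopologicalSpace T] {f : DoubleCylinder d → T} :
    Continuous f ↔ Continuous (f ∘ vert d) ∧ Continuous (f ∘ cyl d) := by
  have h : Continuous f ↔ Continuous (f ∘ Quot.mk (CylinderGlue d)) :=
    (isQuotientMap_quot_mk (r := CylinderGlue d)).continuous_iff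
  rw [h, continuous_sum_dom]
  rfl

/-- A point of the cylinder in normal form. -/
noncomputable def normalForm (d : Bool → C(E, V)) :
    V ⊕ E × SignedInterval → V ⊕ E × SignedInterval
  | Sum.inl v => Sum.inl v
  | Sum.inr x => open Classical in
      if x.2 = endpt true then Sum.inl (d true x.1)
      else if x.2 = endpt false then Sum.inl (d false x.1) else Sum.inr x

theorem normalForm_endpt (s : Bool) (x : E) :
    normalForm d (Sum.inr (x, endpt s)) = Sum.inl (d s x) := by
  cases s
  · have : endpt false ≠ endpt true := fun h => by simpa using endpt_injective h
    simp [normalForm, this]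
  · simp [normalForm]

theorem normalForm_of_ne {x : E × SignedInterval} (h : ∀ s, x.2 ≠ endpt s) :
    normalForm d (Sum.inr x) = Sum.inr x := by
  simp [normalForm, h]

/-- The normal form as a function on the double mapping cylinder. -/
noncomputable def nf : DoubleCylinder d → V ⊕ E × SignedInterval :=
  Quot.lift (normalForm d) (by
    rintro _ _ ⟨s, x⟩
    exact normalForm_endpt s x)

theorem vert_injective : Function.Injective (vert d) := fun v w h => by
  have := congrArg nf h
  exact Sum.inl_injective this

theorem cyl_inj {x y : E × SignedInterval} (hx : ∀ s, x.2 ≠ endpt s) (hy : ∀ s, y.2 ≠ endpt s)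
    (h : cyl d x = cyl d y) : x = y := by
  have : normalForm d (Sum.inr x) = normalForm d (Sum.inr y) := congrArg nf h
  rw [normalForm_of_ne hx, normalForm_of_ne hy] at this
  exact Sum.inr_injective this

theorem cyl_ne_vert {x : E × SignedInterval} (hx : ∀ s, x.2 ≠ endpt s) (v : V) :
    cyl d x ≠ vert d v := by
  intro h
  have : normalForm d (Sum.inr x) = Sum.inl v := congrArg nf h
  rw [normalForm_of_ne hx] at this
  cases this

theorem vert_or_cyl (q : DoubleCylinder d) :
    (∃ v, q = vert d v) ∨ ∃ x, (∀ s, x.2 ≠ endpt s) ∧ q = cyl d x := by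
  induction q using Quot.ind with | mk q => ?_
  rcases q with v | ⟨x, t⟩
  · exact Or.inl ⟨v, rfl⟩
  · by_cases h : ∃ s, t = endpt s
    · obtain ⟨s, rfl⟩ := h
      exact Or.inl ⟨d s x, cyl_endpt s x⟩
    · push Not at h
      exact Or.inr ⟨(x, t), h, rfl⟩

/-- The subset of the double mapping cylinder with given traces on the pieces. -/
def glueSet (M : Set V) (N : Set (E × SignedInterval))
    (h : ∀ s x, (x, endpt s) ∈ N ↔ d s x ∈ M) : Set (DoubleCylinder d) :=
  {q | Quot.lift (Sum.elim (fun v => v ∈ M) fun x => x ∈ N) (by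
    rintro _ _ ⟨s, x⟩
    exact propext (h s x)) q}

/-- The points `(x, t)` with `t ≠ 0` for which the nearer end of `{x} × [-1, 1]` lies in `M`. -/
def collar (d : Bool → C(E, V)) (M : Set V) : Set (E × SignedInterval) :=
  {x | (0 < x.2.1 ∧ d true x.1 ∈ M) ∨ (x.2.1 < 0 ∧ d false x.1 ∈ M)}

theorem endpt_mem_collar {M : Set V} (s : Bool) (x : E) : (x, endpt s) ∈ collar d M ↔ d s x ∈ M := by
  cases s <;> simp [collar, endpt]

theorem isOpen_collar {M : Set V} (hM : IsOpen M) : IsOpen (collar d M) := by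
  change IsOpen ({x : E × SignedInterval | 0 < x.2.1 ∧ d true x.1 ∈ M} ∪
    {x | x.2.1 < 0 ∧ d false x.1 ∈ M})
  refine IsOpen.union (IsOpen.inter ?_ (hM.preimage ((d true).continuous.comp continuous_fst)))
    (IsOpen.inter ?_ (hM.preimage ((d false).continuous.comp continuous_fst)))
  · exact isOpen_lt continuous_const (continuous_subtype_val.comp continuous_snd)
  · exact isOpen_lt (continuous_subtype_val.comp continuous_snd) continuous_const

/-- The open neighbourhood of `M` obtained by adding half of each adjacent cylinder. -/
def starNhd (d : Bool → C(E, V)) (M : Set V) : Set (DoubleCylinder d) :=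
  glueSet M (collar d M) endpt_mem_collar

theorem isOpen_starNhd {M : Set V} (hM : IsOpen M) : IsOpen (starNhd d M) :=
  isOpen_iff.2 ⟨hM, isOpen_collar hM⟩

/-- The open set of points `(x, t)` with `x ∈ N` and `-1 < t < 1`. -/
def openCyl (d : Bool → C(E, V)) (N : Set E) : Set (DoubleCylinder d) :=
  glueSet ∅ {x | x.1 ∈ N ∧ ∀ s, x.2 ≠ endpt s} (fun s x => by
    simp only [Set.mem_ofPred_eq, Set.mem_empty_iff_false, iff_false]
    exact fun h => h.2 s rfl)

theorem isOpen_openCyl {N : Set E} (hN : IsOpen N) : IsOpen (openCyl d N) := by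
  refine isOpen_iff.2 ⟨isOpen_empty, ?_⟩
  refine IsOpen.inter (hN.preimage continuous_fst) ?_
  have : {x : E × SignedInterval | ∀ s, x.2 ≠ endpt s} = ⋂ s, {x | x.2 ≠ endpt s} := by
    ext; simp
  change IsOpen {x : E × SignedInterval | ∀ s, x.2 ≠ endpt s}
  rw [this]
  exact isOpen_iInter_of_finite fun s => isOpen_ne.preimage continuous_snd

section Map

variable {V' E' : Type u} [TopologicalSpace V'] [TopologicalSpace E'] {d' : Bool → C(E', V')}
  (gV : C(V', V)) (gE : C(E', E)) (comm : ∀ s z, gV (d' s z) = d s (gE z))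

/-- The map of double mapping cylinders induced by a map of diagrams. -/
def map : DoubleCylinder d' → DoubleCylinder d :=
  Quot.map (Sum.map gV (Prod.map gE id)) (by
    rintro _ _ ⟨s, x⟩
    have h := CylinderGlue.mk (d := d) s (gE x)
    rw [← comm] at h
    exact h)

theorem map_vert (z : V') : map gV gE comm (vert d' z) = vert d (gV z) := rfl

theorem map_cyl (z : E' × SignedInterval) : map gV gE comm (cyl d' z) = cyl d (gE z.1, z.2) := rfl

theorem continuous_map : Continuous (map gV gE comm) := by
  refine continuous_iff.2 ⟨?_, ?_⟩
  · exact continuous_vert.comp gV.continuous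
  · exact continuous_cyl.comp (gE.continuous.prodMap continuous_id)

theorem eq_vert_of_map_eq_vert {q : DoubleCylinder d'} {v : V} (h : map gV gE comm q = vert d v) :
    ∃ z, q = vert d' z ∧ gV z = v := by
  rcases vert_or_cyl q with ⟨z, rfl⟩ | ⟨x, hx, rfl⟩
  · exact ⟨z, rfl, vert_injective h⟩
  · exact absurd h (cyl_ne_vert (x := (gE x.1, x.2)) hx v)

theorem eq_cyl_of_map_eq_cyl {q : DoubleCylinder d'} {x : E × SignedInterval}
    (hx : ∀ s, x.2 ≠ endpt s) (h : map gV gE comm q = cyl d x) :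
    ∃ z, q = cyl d' (z, x.2) ∧ gE z = x.1 := by
  rcases vert_or_cyl q with ⟨z, rfl⟩ | ⟨z, hz, rfl⟩
  · exact absurd h.symm (cyl_ne_vert hx _)
  · have := cyl_inj (x := (gE z.1, z.2)) hz hx h
    subst this
    exact ⟨z.1, rfl, rfl⟩

/-- Only the ends of cylinders need care: a point of `V'` over `d s x` must be the end of an edge
over `x`, which is the hypothesis `lift`. -/
theorem isOpenMap_map (hV : IsOpenMap gV) (hE : IsOpenMap gE)
    (lift : ∀ s x z, d s x = gV z → ∃ y, gE y = x ∧ d' s y = z) :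
    IsOpenMap (map gV gE comm) := by
  intro G hG
  obtain ⟨hGV, hGE⟩ := isOpen_iff.1 hG
  refine isOpen_iff.2 ⟨?_, ?_⟩
  · convert hV _ hGV using 1
    ext v
    constructor
    · rintro ⟨q, hq, h⟩
      obtain ⟨z, rfl, rfl⟩ := eq_vert_of_map_eq_vert gV gE comm h
      exact ⟨z, hq, rfl⟩
    · rintro ⟨z, hz, rfl⟩
      exact ⟨_, hz, rfl⟩
  · convert (hE.prodMap IsOpenMap.id) _ hGE using 1
    ext ⟨x, t⟩
    constructor
    · rintro ⟨q, hq, h⟩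
      by_cases ht : ∃ s, t = endpt s
      · obtain ⟨s, rfl⟩ := ht
        rw [cyl_endpt] at h
        obtain ⟨z, rfl, hz⟩ := eq_vert_of_map_eq_vert gV gE comm h
        obtain ⟨y, rfl, rfl⟩ := lift s x z hz.symm
        exact ⟨(y, endpt s), by rw [Set.mem_preimage, cyl_endpt]; exact hq, rfl⟩
      · push Not at ht
        obtain ⟨z, rfl, hz⟩ := eq_cyl_of_map_eq_cyl gV gE comm (x := (x, t)) ht h
        exact ⟨(z, t), hq, Prod.ext hz rfl⟩
    · rintro ⟨⟨z, t'⟩, hz, h⟩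
      obtain ⟨rfl, rfl⟩ := Prod.ext_iff.1 h
      exact ⟨_, hz, rfl⟩

/-- The hypotheses `lift` and `inj` say that, for each `s`, the points of `E'` are exactly those of
the pullback of `gV` along `d s`. Hence the half-cylinders attached to a sheet of `gV` project
bijectively, and star neighbourhoods of sheets are again sheets. Away from the vertex space the
sheets come from `gE`. -/
theorem isCoveringMap_map (hV : IsCoveringMap gV) (hE : IsCoveringMap gE)
    (lift : ∀ s x z, d s x = gV z → ∃ y, gE y = x ∧ d' s y = z)
    (inj : ∀ s y y', gE y = gE y' → d' s y = d' s y' → y = y') :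
    IsCoveringMap (map gV gE comm) := by
  have hmap := map_cyl gV gE comm
  refine isCoveringMap_of_isSheets (continuous_map gV gE comm)
    (isOpenMap_map gV gE comm hV.isOpenMap hE.isOpenMap lift) fun q => ?_
  rcases vert_or_cyl q with ⟨v, rfl⟩ | ⟨⟨x, t⟩, hx, rfl⟩
  · obtain ⟨U, O, hv, hO⟩ := hV.exists_isSheets v
    refine ⟨starNhd d U, _, fun s => starNhd d' (O s), hv, isOpen_starNhd hO.isOpen_base,
      fun s => isOpen_starNhd (hO.isOpen s), ?_, ?_, ?_, ?_, ?_⟩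
    · intro s q hq
      induction q using Quot.ind with | mk q => ?_
      rcases q with z | ⟨y, t⟩
      · exact hO.mem_base s z hq
      · rcases hq with ⟨h1, h2⟩ | ⟨h1, h2⟩
        · exact Or.inl ⟨h1, by simpa [comm] using hO.mem_base s _ h2⟩
        · exact Or.inr ⟨h1, by simpa [comm] using hO.mem_base s _ h2⟩
    · intro s q hq
      induction q using Quot.ind with | mk q => ?_
      rcases q with b | ⟨x, t⟩
      · obtain ⟨z, hz, rfl⟩ := hO.exists_lift s b hq
        exact ⟨vert d' z, hz, rfl⟩
      · rcases hq with ⟨h1, h2⟩ | ⟨h1, h2⟩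
        · obtain ⟨z, hz, hzx⟩ := hO.exists_lift s _ h2
          obtain ⟨y, rfl, rfl⟩ := lift _ _ z hzx.symm
          exact ⟨cyl d' (y, t), Or.inl ⟨h1, hz⟩, rfl⟩
        · obtain ⟨z, hz, hzx⟩ := hO.exists_lift s _ h2
          obtain ⟨y, rfl, rfl⟩ := lift _ _ z hzx.symm
          exact ⟨cyl d' (y, t), Or.inr ⟨h1, hz⟩, rfl⟩
    · intro s q hq q' hq' h
      rcases vert_or_cyl q with ⟨z, rfl⟩ | ⟨⟨y, t⟩, hy, rfl⟩
      · rw [map_vert] at h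
        obtain ⟨z', rfl, hz⟩ := eq_vert_of_map_eq_vert gV gE comm h.symm
        rw [hO.inj s z hq z' hq' hz.symm]
      · rw [map_cyl] at h
        obtain ⟨y', rfl, hz⟩ := eq_cyl_of_map_eq_cyl gV gE comm hy h.symm
        simp only at hz hq'
        have key : y = y' := by
          rcases hq with ⟨h1, h2⟩ | ⟨h1, h2⟩ <;> rcases hq' with ⟨h3, h4⟩ | ⟨h3, h4⟩
          · exact inj _ _ _ hz.symm (hO.inj s _ h2 _ h4 (by rw [comm, comm, hz]))
          · exact absurd h1 (not_lt.2 h3.le)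
          · exact absurd h3 (not_lt.2 h1.le)
          · exact inj _ _ _ hz.symm (hO.inj s _ h2 _ h4 (by rw [comm, comm, hz]))
        rw [key]
    · intro q hq
      induction q using Quot.ind with | mk q => ?_
      rcases q with z | ⟨y, t⟩
      · exact hO.cover z hq
      · rcases hq with ⟨h1, h2⟩ | ⟨h1, h2⟩
        · obtain ⟨s, hs⟩ := hO.cover (d' true y) (by rw [comm]; exact h2)
          exact ⟨s, Or.inl ⟨h1, hs⟩⟩
        · obtain ⟨s, hs⟩ := hO.cover (d' false y) (by rw [comm]; exact h2)
          exact ⟨s, Or.inr ⟨h1, hs⟩⟩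
    · intro q s s' hq hq'
      induction q using Quot.ind with | mk q => ?_
      rcases q with z | ⟨y, t⟩
      · exact hO.disj z s s' hq hq'
      · rcases hq with ⟨h1, h2⟩ | ⟨h1, h2⟩ <;> rcases hq' with ⟨h3, h4⟩ | ⟨h3, h4⟩
        · exact hO.disj _ s s' h2 h4
        · exact absurd h1 (not_lt.2 h3.le)
        · exact absurd h3 (not_lt.2 h1.le)
        · exact hO.disj _ s s' h2 h4
  · obtain ⟨U, O, hv, hO⟩ := hE.exists_isSheets x
    refine ⟨openCyl d U, _, fun s => openCyl d' (O s), ⟨hv, hx⟩, isOpen_openCyl hO.isOpen_base,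
      fun s => isOpen_openCyl (hO.isOpen s), ?_, ?_, ?_, ?_, ?_⟩
    · intro s q hq
      induction q using Quot.ind with | mk q => ?_
      rcases q with z | ⟨y, t⟩
      · exact hq
      · exact ⟨hO.mem_base s _ hq.1, hq.2⟩
    · intro s q hq
      induction q using Quot.ind with | mk q => ?_
      rcases q with b | ⟨x, t⟩
      · exact hq.elim
      · obtain ⟨y, hy, rfl⟩ := hO.exists_lift s x hq.1
        exact ⟨cyl d' (y, t), ⟨hy, hq.2⟩, rfl⟩
    · intro s q hq q' hq' h
      induction q using Quot.ind with | mk q => ?_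
      rcases q with z | ⟨y, t⟩
      · exact hq.elim
      · change cyl d (gE y, t) = _ at h
        obtain ⟨y', rfl, hz⟩ := eq_cyl_of_map_eq_cyl gV gE comm (x := (gE y, t)) hq.2 h.symm
        rw [hO.inj s y hq.1 y' hq'.1 hz.symm]
        rfl
    · intro q hq
      induction q using Quot.ind with | mk q => ?_
      rcases q with z | ⟨y, t⟩
      · exact hq.elim
      · obtain ⟨s, hs⟩ := hO.cover y hq.1
        exact ⟨s, hs, hq.2⟩
    · intro q s s' hq hq'
      induction q using Quot.ind with | mk q => ?_
      rcases q with z | ⟨y, t⟩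
      · exact hq.elim
      · exact hO.disj y s s' hq.1 hq'.1

theorem surjective_map (hV : Function.Surjective gV) (hE : Function.Surjective gE) :
    Function.Surjective (map gV gE comm) := by
  intro q
  induction q using Quot.ind with | mk q => ?_
  rcases q with b | ⟨x, t⟩
  · obtain ⟨z, rfl⟩ := hV b
    exact ⟨vert d' z, rfl⟩
  · obtain ⟨z, rfl⟩ := hE x
    exact ⟨cyl d' (z, t), rfl⟩

theorem finiteSheeted_map (hV : FiniteSheeted gV) (hE : FiniteSheeted gE) :
    FiniteSheeted (map gV gE comm) := by
  intro q
  rcases vert_or_cyl q with ⟨v, rfl⟩ | ⟨x, hx, rfl⟩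
  · refine ((hV v).image (vert d')).subset ?_
    intro q hq
    obtain ⟨z, rfl, hz⟩ := eq_vert_of_map_eq_vert gV gE comm hq
    exact ⟨z, hz, rfl⟩
  · refine ((hE x.1).image fun z => cyl d' (z, x.2)).subset ?_
    intro q hq
    obtain ⟨z, rfl, hz⟩ := eq_cyl_of_map_eq_cyl gV gE comm hx hq
    exact ⟨z, hz, rfl⟩

/-- Closed embeddings are the suitable notion here: the trace of an image on the cylinder consists
of the image of the trace and of further ends of edges attached to the image in `V`, and both sets
are closed. -/
theorem isClosedEmbedding_map (hV : IsClosedEmbedding gV) (hE : IsClosedEmbedding gE) :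
    IsClosedEmbedding (map gV gE comm) := by
  refine .of_continuous_injective_isClosedMap (continuous_map gV gE comm) ?_ ?_
  · intro q q' h
    rcases vert_or_cyl q with ⟨z, rfl⟩ | ⟨⟨y, t⟩, hy, rfl⟩
    · obtain ⟨z', rfl, hz⟩ := eq_vert_of_map_eq_vert gV gE comm h.symm
      rw [hV.injective hz]
    · obtain ⟨y', rfl, hz⟩ := eq_cyl_of_map_eq_cyl gV gE comm hy h.symm
      rw [← hE.injective hz]
      rfl
  · intro G hG
    obtain ⟨hGV, hGE⟩ := isClosed_iff.1 hG
    have hM := hV.isClosedMap _ hGV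
    refine isClosed_iff.2 ⟨?_, ?_⟩
    · convert hM using 1
      ext v
      constructor
      · rintro ⟨q, hq, h⟩
        obtain ⟨z, rfl, rfl⟩ := eq_vert_of_map_eq_vert gV gE comm h
        exact ⟨z, hq, rfl⟩
      · rintro ⟨z, hz, rfl⟩
        exact ⟨_, hz, rfl⟩
    · have h1 : IsClosed (⋃ s, {x : E × SignedInterval | x.2 = endpt s ∧ d s x.1 ∈ gV '' (vert d' ⁻¹' G)}) :=
        isClosed_iUnion_of_finite fun s => (isClosed_singleton.preimage continuous_snd).inter
          (hM.preimage ((d s).continuous.comp continuous_fst))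
      convert ((hE.prodMap (IsClosedEmbedding.id (X := SignedInterval))).isClosedMap _ hGE).union h1 using 1
      ext ⟨x, t⟩
      constructor
      · rintro ⟨q, hq, h⟩
        by_cases ht : ∃ s, t = endpt s
        · obtain ⟨s, rfl⟩ := ht
          rw [cyl_endpt] at h
          obtain ⟨z, rfl, hz⟩ := eq_vert_of_map_eq_vert gV gE comm h
          exact Or.inr (Set.mem_iUnion.2 ⟨s, rfl, z, hq, hz⟩)
        · push Not at ht
          obtain ⟨z, rfl, hz⟩ := eq_cyl_of_map_eq_cyl gV gE comm (x := (x, t)) ht h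
          exact Or.inl ⟨(z, t), hq, Prod.ext hz rfl⟩
      · rintro (⟨⟨z, t'⟩, hz, h⟩ | h)
        · obtain ⟨rfl, rfl⟩ := Prod.ext_iff.1 h
          exact ⟨_, hz, rfl⟩
        · obtain ⟨s, hs, z, hz, hzx⟩ := Set.mem_iUnion.1 h
          obtain rfl : t = endpt s := hs
          exact ⟨vert d' z, hz, by rw [map_vert, hzx, cyl_endpt]⟩

end Map

end DoubleCylinder

end DoubleMappingCylinder

/-! ### Realizations as double mapping cylinders. -/

namespace GraphOfSpaces

/-- The edge maps of a graph of spaces, on the total space of all edge spaces. -/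
def totalBd (X : GraphOfSpaces.{u}) (s : Bool) : C(Σ e : X.E, X.edge e, Σ v : X.V, X.vert v) where
  toFun x := X.bd x.1 s x.2
  continuous_toFun := continuous_sigma fun e => (X.bd e s).continuous

/-- The associated topological space is the double mapping cylinder of the total edge maps. -/
def realizationHomeo (X : GraphOfSpaces.{u}) : X.Realization ≃ₜ DoubleCylinder X.totalBd where
  toFun := Quot.map (Sum.map id fun x => (⟨x.1, x.2.1⟩, x.2.2)) (by
    rintro _ _ ⟨e, s, x⟩
    exact CylinderGlue.mk (d := X.totalBd) s ⟨e, x⟩)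
  invFun := Quot.map (Sum.map id fun x => ⟨x.1.1, x.1.2, x.2⟩) (by
    rintro _ _ ⟨s, e, x⟩
    exact Glue.mk e s x)
  left_inv := by
    rintro ⟨v | ⟨e, x, t⟩⟩ <;> rfl
  right_inv := by
    rintro ⟨v | ⟨⟨e, x⟩, t⟩⟩ <;> rfl
  continuous_toFun := by
    refine continuous_quot_lift _ (continuous_quot_mk.comp (Continuous.sumMap continuous_id ?_))
    exact (Homeomorph.sigmaProdDistrib (X := fun e => X.edge e) (Y := SignedInterval)).symm.continuous
  continuous_invFun := by
    refine continuous_quot_lift _ (continuous_quot_mk.comp (Continuous.sumMap continuous_id ?_))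
    exact (Homeomorph.sigmaProdDistrib (X := fun e => X.edge e) (Y := SignedInterval)).continuous

end GraphOfSpaces

/-! ### Permutations all of whose cycles have the same length. -/

section FreePermutations

/-- A finite set with a permutation all of whose cycles have length `N` is a union of standard
cycles. -/
theorem Equiv.Perm.exists_equiv_prod_zmod {S : Type u} (T : Equiv.Perm S) {N : ℕ}
    [NeZero N] (h : ∀ (s : S) (n : ℤ), (T ^ n) s = s ↔ (N : ℤ) ∣ n) :
    ∃ (Q : Type u) (f : Q × ZMod N ≃ S), ∀ o n, T (f (o, n)) = f (o, n + 1) := by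
  have hT : ∀ (s : S) (m n : ℤ), (T ^ m) s = (T ^ n) s ↔ (N : ℤ) ∣ m - n := by
    intro s m n
    rw [← h s, sub_eq_neg_add, zpow_add, Equiv.Perm.mul_apply, zpow_neg, Equiv.Perm.inv_eq_iff_eq]
  let r : Setoid S := Equiv.Perm.SameCycle.setoid T
  let f : Quotient r × ZMod N → S := fun x => (T ^ (x.2.val : ℤ)) x.1.out
  have hinj : Function.Injective f := by
    rintro ⟨o, m⟩ ⟨o', n⟩ hmn
    have h1 : o = o' := by
      rw [← o.out_eq, ← o'.out_eq]
      refine Quotient.sound (⟨-n.val + m.val, ?_⟩ : T.SameCycle _ _)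
      rw [zpow_add, Equiv.Perm.mul_apply, zpow_neg, Equiv.Perm.inv_eq_iff_eq]
      exact hmn
    subst h1
    have h2 := (hT _ _ _).1 hmn
    rw [← ZMod.intCast_zmod_eq_zero_iff_dvd] at h2
    push_cast at h2
    rw [ZMod.natCast_zmod_val, ZMod.natCast_zmod_val, sub_eq_zero] at h2
    rw [h2]
  have hsurj : Function.Surjective f := by
    intro s
    have : T.SameCycle (Quotient.mk r s).out s := Quotient.exact (s := r) (Quotient.out_eq _)
    obtain ⟨n, hn⟩ := this
    refine ⟨(Quotient.mk r s, (n : ZMod N)), Eq.trans ((hT _ _ _).2 ?_) hn⟩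
    rw [← ZMod.intCast_zmod_eq_zero_iff_dvd]
    simp
  refine ⟨Quotient r, Equiv.ofBijective f ⟨hinj, hsurj⟩, fun o n => ?_⟩
  change T ((T ^ (n.val : ℤ)) o.out) = (T ^ ((n + 1).val : ℤ)) o.out
  rw [← Equiv.Perm.mul_apply, ← zpow_one_add, hT, ← ZMod.intCast_zmod_eq_zero_iff_dvd]
  simp [add_comm]

/-- All cycles have length `N`, so equal cardinality means equally many cycles, and any bijection
between the sets of cycles gives a conjugation. -/
theorem Equiv.Perm.exists_conj_of_free {S₁ S₂ : Type*} [Finite S₁] [Finite S₂]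
    (T₁ : Equiv.Perm S₁) (T₂ : Equiv.Perm S₂) {N : ℕ} [NeZero N]
    (h₁ : ∀ (s : S₁) (n : ℤ), (T₁ ^ n) s = s ↔ (N : ℤ) ∣ n)
    (h₂ : ∀ (s : S₂) (n : ℤ), (T₂ ^ n) s = s ↔ (N : ℤ) ∣ n) (hcard : Nat.card S₁ = Nat.card S₂) :
    ∃ θ : S₁ ≃ S₂, ∀ s, θ (T₁ s) = T₂ (θ s) := by
  obtain ⟨Q₁, f₁, hf₁⟩ := T₁.exists_equiv_prod_zmod h₁
  obtain ⟨Q₂, f₂, hf₂⟩ := T₂.exists_equiv_prod_zmod h₂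
  have : Finite (Q₁ × ZMod N) := Finite.of_equiv _ f₁.symm
  have : Finite (Q₂ × ZMod N) := Finite.of_equiv _ f₂.symm
  have : Finite Q₁ := Finite.of_injective (fun q => (q, (0 : ZMod N))) fun a b h => congrArg Prod.fst h
  have : Finite Q₂ := Finite.of_injective (fun q => (q, (0 : ZMod N))) fun a b h => congrArg Prod.fst h
  have hQ : Nat.card Q₁ = Nat.card Q₂ := by
    have h := (Nat.card_congr f₁).trans (hcard.trans (Nat.card_congr f₂).symm)
    rw [Nat.card_prod, Nat.card_prod, Nat.card_zmod] at h
    exact Nat.eq_of_mul_eq_mul_right (Nat.pos_of_ne_zero (NeZero.ne N)) h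
  obtain ⟨e⟩ := Finite.card_eq.1 hQ
  refine ⟨f₁.symm.trans ((Equiv.prodCongr e (Equiv.refl _)).trans f₂), fun s => ?_⟩
  obtain ⟨⟨o, n⟩, rfl⟩ := f₁.surjective s
  rw [hf₁]
  simp [hf₂]

theorem Equiv.Perm.apply_mem_compl_range_iff {S K : Type*} (T' : Equiv.Perm S) (T : Equiv.Perm K)
    (k : K → S) (e : ∀ x, k (T x) = T' (k x)) (s : S) :
    T' s ∈ (Set.range k)ᶜ ↔ s ∈ (Set.range k)ᶜ := by
  rw [Set.mem_compl_iff, Set.mem_compl_iff, not_iff_not]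
  constructor
  · rintro ⟨x, hx⟩
    exact ⟨T⁻¹ x, T'.injective (by rw [← e, ← hx]; simp)⟩
  · rintro ⟨x, rfl⟩
    exact ⟨T x, e x⟩

/-- The images of `K` are invariant, hence unions of whole cycles. Their complements are therefore
again unions of `N`-cycles and have equal cardinality, so they are conjugate, and this conjugation
is combined with the one prescribed on the images. -/
theorem Equiv.Perm.exists_conj_extending {S₁ S₂ K : Type*} [Finite S₁] [Finite S₂]
    (T₁ : Equiv.Perm S₁) (T₂ : Equiv.Perm S₂) (T : Equiv.Perm K) {N : ℕ} [NeZero N]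
    (h₁ : ∀ (s : S₁) (n : ℤ), (T₁ ^ n) s = s ↔ (N : ℤ) ∣ n)
    (h₂ : ∀ (s : S₂) (n : ℤ), (T₂ ^ n) s = s ↔ (N : ℤ) ∣ n) (hcard : Nat.card S₁ = Nat.card S₂)
    (k₁ : K → S₁) (k₂ : K → S₂) (hk₁ : Function.Injective k₁) (hk₂ : Function.Injective k₂)
    (e₁ : ∀ x, k₁ (T x) = T₁ (k₁ x)) (e₂ : ∀ x, k₂ (T x) = T₂ (k₂ x)) :
    ∃ θ : S₁ ≃ S₂, (∀ s, θ (T₁ s) = T₂ (θ s)) ∧ ∀ x, θ (k₁ x) = k₂ x := by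
  classical
  let R₁ := T₁.subtypePerm (T₁.apply_mem_compl_range_iff T k₁ e₁)
  let R₂ := T₂.subtypePerm (T₂.apply_mem_compl_range_iff T k₂ e₂)
  have hr₁ : Nat.card (Set.range k₁) = Nat.card K := Nat.card_congr (Equiv.ofInjective k₁ hk₁).symm
  have hr₂ : Nat.card (Set.range k₂) = Nat.card K := Nat.card_congr (Equiv.ofInjective k₂ hk₂).symm
  have hc : Nat.card ↥(Set.range k₁)ᶜ = Nat.card ↥(Set.range k₂)ᶜ := by
    have a₁ := Nat.card_congr (Equiv.Set.sumCompl (Set.range k₁))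
    have a₂ := Nat.card_congr (Equiv.Set.sumCompl (Set.range k₂))
    rw [Nat.card_sum] at a₁ a₂
    omega
  obtain ⟨φ, hφ⟩ := Equiv.Perm.exists_conj_of_free R₁ R₂ (N := N)
    (fun s n => by rw [← h₁ s n, Equiv.Perm.subtypePerm_zpow, Subtype.ext_iff]; rfl)
    (fun s n => by rw [← h₂ s n, Equiv.Perm.subtypePerm_zpow, Subtype.ext_iff]; rfl) hc
  let θ : S₁ ≃ S₂ := (Equiv.Set.sumCompl (Set.range k₁)).symm.trans
    ((Equiv.sumCongr ((Equiv.ofInjective k₁ hk₁).symm.trans (Equiv.ofInjective k₂ hk₂)) φ).trans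
      (Equiv.Set.sumCompl (Set.range k₂)))
  have hθ₁ : ∀ x, θ (k₁ x) = k₂ x := by
    intro x
    simp only [θ, Equiv.trans_apply]
    rw [Equiv.Set.sumCompl_symm_apply_of_mem (Set.mem_range_self x)]
    simp
  have hθ₂ : ∀ s : ↥(Set.range k₁)ᶜ, θ s = φ s := by
    intro s
    simp only [θ, Equiv.trans_apply]
    rw [Equiv.Set.sumCompl_symm_apply_of_notMem s.2]
    simp
  refine ⟨θ, fun s => ?_, hθ₁⟩
  by_cases hs : s ∈ Set.range k₁
  · obtain ⟨x, rfl⟩ := hs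
    rw [← e₁, hθ₁, hθ₁, e₂]
  · have := hφ ⟨s, hs⟩
    rw [hθ₂ ⟨s, hs⟩, show T₁ s = R₁ ⟨s, hs⟩ from rfl, hθ₂, this]
    rfl

end FreePermutations

/-! ### Monodromy of coverings of disjoint unions of circles. -/

section CircleFamily

variable {B : Type*} [TopologicalSpace B] {ι : Type*}

/-- The maps `q i` exhibit `B` as a disjoint union of circles `ℝ ⧸ ℤ`. -/
structure IsCircleFamily (q : ι → C(ℝ, B)) : Prop where
  isLocalHomeomorph : ∀ i, IsLocalHomeomorph (q i)
  surjective : ∀ b, ∃ i t, q i t = b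
  eq_iff : ∀ i j s t, q i s = q j t ↔ i = j ∧ ∃ n : ℤ, s = t + n

variable {q : ι → C(ℝ, B)} {E : Type*} [TopologicalSpace E] {p : E → B}

theorem IsCoveringMap.exists_lift_real (hp : IsCoveringMap p) (γ : C(ℝ, B)) (t : ℝ) (z : E)
    (hz : p z = γ t) : ∃ l : C(ℝ, E), l t = z ∧ ∀ t, p (l t) = γ t := by
  obtain ⟨l, ⟨h1, h2⟩, -⟩ := hp.existsUnique_continuousMap_lifts γ (a₀ := t) (e₀ := z) hz
  exact ⟨l, h1, fun t => congrFun h2 t⟩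

theorem IsCoveringMap.lift_real_unique (hp : IsCoveringMap p) {l l' : C(ℝ, E)}
    (h : ∀ t, p (l t) = p (l' t)) {t : ℝ} (ht : l t = l' t) : l = l' :=
  DFunLike.coe_injective (hp.eq_of_comp_eq l.continuous l'.continuous (funext h) t ht)

variable (hq : IsCircleFamily q) (hp : IsCoveringMap p)

/-- The lift of `q i` starting at a given point of the fibre over `q i 0`. -/
noncomputable def fiberLift (q : ι → C(ℝ, B)) (hp : IsCoveringMap p) (i : ι) (s : p ⁻¹' {q i 0}) :
    C(ℝ, E) :=
  (hp.exists_lift_real (q i) 0 s.1 s.2).choose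

theorem fiberLift_zero (i : ι) (s : p ⁻¹' {q i 0}) : fiberLift q hp i s 0 = s :=
  (hp.exists_lift_real (q i) 0 s.1 s.2).choose_spec.1

theorem proj_fiberLift (i : ι) (s : p ⁻¹' {q i 0}) (t : ℝ) : p (fiberLift q hp i s t) = q i t :=
  (hp.exists_lift_real (q i) 0 s.1 s.2).choose_spec.2 t

theorem eq_fiberLift {i : ι} {s : p ⁻¹' {q i 0}} {l : C(ℝ, E)} (h0 : l 0 = s)
    (h : ∀ t, p (l t) = q i t) : l = fiberLift q hp i s :=
  hp.lift_real_unique (t := 0) (fun t => by rw [h, proj_fiberLift hp]) (by rw [h0, fiberLift_zero])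

include hq in
theorem IsCircleFamily.add_int (i : ι) (t : ℝ) (n : ℤ) : q i (t + n) = q i t :=
  (hq.eq_iff i i _ _).2 ⟨rfl, n, rfl⟩

/-- The action of the `n`-th power of the monodromy. -/
noncomputable def fiberShift (hq : IsCircleFamily q) (hp : IsCoveringMap p) (i : ι) (n : ℤ)
    (s : p ⁻¹' {q i 0}) : p ⁻¹' {q i 0} :=
  ⟨fiberLift q hp i s n, by
    rw [Set.mem_preimage, proj_fiberLift hp, Set.mem_singleton_iff]
    simpa using hq.add_int i 0 n⟩

theorem fiberLift_fiberShift (i : ι) (n : ℤ) (s : p ⁻¹' {q i 0}) (t : ℝ) :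
    fiberLift q hp i (fiberShift hq hp i n s) t = fiberLift q hp i s (t + n) := by
  let l : C(ℝ, E) := (fiberLift q hp i s).comp ⟨fun t => t + n, by fun_prop⟩
  have : l = fiberLift q hp i (fiberShift hq hp i n s) := by
    refine eq_fiberLift hp ?_ fun t => ?_
    · simp [l, fiberShift]
    · simp only [l, ContinuousMap.comp_apply, ContinuousMap.coe_mk, proj_fiberLift hp]
      exact hq.add_int i t n
  rw [← this]
  rfl

/-- The monodromy of a covering of a union of circles. -/
noncomputable def circleMonodromy (hq : IsCircleFamily q) (hp : IsCoveringMap p) (i : ι) :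
    Equiv.Perm (p ⁻¹' {q i 0}) where
  toFun := fiberShift hq hp i 1
  invFun := fiberShift hq hp i (-1)
  left_inv s := Subtype.ext (by
    conv_lhs => rw [fiberShift]
    simp [fiberLift_fiberShift, fiberLift_zero])
  right_inv s := Subtype.ext (by
    conv_lhs => rw [fiberShift]
    simp [fiberLift_fiberShift, fiberLift_zero])

theorem circleMonodromy_zpow (i : ι) (n : ℤ) (s : p ⁻¹' {q i 0}) :
    (circleMonodromy hq hp i ^ n) s = fiberShift hq hp i n s := by
  have h1 : ∀ s, circleMonodromy hq hp i s = fiberShift hq hp i 1 s := fun s => rfl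
  have h2 : ∀ s, (circleMonodromy hq hp i)⁻¹ s = fiberShift hq hp i (-1) s := fun s => rfl
  have hadd : ∀ m n s, fiberShift hq hp i m (fiberShift hq hp i n s) =
      fiberShift hq hp i (m + n) s := fun m n s => Subtype.ext (by
    change fiberLift q hp i (fiberShift hq hp i n s) m = fiberLift q hp i s _
    rw [fiberLift_fiberShift]
    push_cast
    rfl)
  induction n with
  | zero => exact Subtype.ext (by simp [fiberShift, fiberLift_zero])
  | succ n ih => rw [add_comm, zpow_one_add, Equiv.Perm.mul_apply, ih, h1, hadd]
  | pred n ih =>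
    rw [sub_eq_neg_add, zpow_add, zpow_neg_one, Equiv.Perm.mul_apply, ih, h2, hadd]

include hq in
theorem exists_eq_fiberLift (z : E) : ∃ i s t, fiberLift q hp i s t = z := by
  obtain ⟨i, t, ht⟩ := hq.surjective (p z)
  obtain ⟨l, hl, hlp⟩ := hp.exists_lift_real (q i) t z ht.symm
  exact ⟨i, ⟨l 0, hlp 0⟩, t, by rw [← eq_fiberLift hp (l := l) rfl hlp, hl]⟩

theorem fiberLift_eq_iff {i : ι} {s s' : p ⁻¹' {q i 0}} {t t' : ℝ}
    (h : fiberLift q hp i s t = fiberLift q hp i s' t') :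
    ∃ n : ℤ, t = t' + n ∧ s' = fiberShift hq hp i n s := by
  have h1 := congrArg p h
  rw [proj_fiberLift hp, proj_fiberLift hp, hq.eq_iff] at h1
  obtain ⟨-, n, rfl⟩ := h1
  refine ⟨n, rfl, Subtype.ext ?_⟩
  rw [← fiberLift_fiberShift hq] at h
  have := hp.lift_real_unique (fun t => by rw [proj_fiberLift hp, proj_fiberLift hp]) h
  rw [← fiberLift_zero hp i s', ← this, fiberLift_zero]

variable {E' : Type*} [TopologicalSpace E'] {p' : E' → B} (hp' : IsCoveringMap p')

-- Each point of `E` lies on a lift of some `q i`, and two lifts through it differ by an integer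
-- shift of the parameter and a power of the monodromy. Equivariance makes the rule well defined.
-- Continuity can be tested along lifts, since these are local homeomorphisms.
include hq in
theorem exists_continuousMap_of_equivariant (θ : ∀ i, p ⁻¹' {q i 0} → p' ⁻¹' {q i 0})
    (hθ : ∀ i s, θ i (circleMonodromy hq hp i s) = circleMonodromy hq hp' i (θ i s)) :
    ∃ Θ : C(E, E'), ∀ i s t, Θ (fiberLift q hp i s t) = fiberLift q hp' i (θ i s) t := by
  have hθn : ∀ i n s, θ i (fiberShift hq hp i n s) = fiberShift hq hp' i n (θ i s) := by
    intro i n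
    have hn : ∀ s, θ i ((circleMonodromy hq hp i ^ n) s) =
        (circleMonodromy hq hp' i ^ n) (θ i s) := by
      have hinv : ∀ s, θ i ((circleMonodromy hq hp i)⁻¹ s) = (circleMonodromy hq hp' i)⁻¹ (θ i s) := by
        intro s
        rw [Equiv.Perm.eq_inv_iff_eq, ← hθ]
        simp
      induction n with
      | zero => intro s; simp
      | succ n ih =>
        intro s
        rw [zpow_add_one, zpow_add_one, Equiv.Perm.mul_apply, Equiv.Perm.mul_apply, ih, hθ]
      | pred n ih =>
        intro s
        rw [zpow_sub_one, zpow_sub_one, Equiv.Perm.mul_apply, Equiv.Perm.mul_apply, ih, hinv]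
    intro s
    rw [← circleMonodromy_zpow, ← circleMonodromy_zpow, hn]
  have wd : ∀ i s t j s' t', fiberLift q hp i s t = fiberLift q hp j s' t' →
      fiberLift q hp' i (θ i s) t = fiberLift q hp' j (θ j s') t' := by
    intro i s t j s' t' h
    have h1 := congrArg p h
    rw [proj_fiberLift hp, proj_fiberLift hp, hq.eq_iff] at h1
    obtain ⟨rfl, -⟩ := h1
    obtain ⟨n, rfl, rfl⟩ := fiberLift_eq_iff hq hp h
    rw [hθn, fiberLift_fiberShift]
  choose i s t hz using exists_eq_fiberLift hq hp
  have key : ∀ j s' t', fiberLift q hp' (i (fiberLift q hp j s' t'))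
      (θ _ (s (fiberLift q hp j s' t'))) (t (fiberLift q hp j s' t')) =
      fiberLift q hp' j (θ j s') t' := fun j s' t' => wd _ _ _ _ _ _ (hz _)
  refine ⟨⟨fun z => fiberLift q hp' (i z) (θ _ (s z)) (t z), ?_⟩, key⟩
  rw [continuous_iff_continuousAt]
  intro z
  obtain ⟨j, s', t', rfl⟩ := exists_eq_fiberLift hq hp z
  have hl : IsLocalHomeomorph (fiberLift q hp j s') := by
    refine IsLocalHomeomorph.of_comp (g := p) ?_ hp.isLocalHomeomorph (fiberLift q hp j s').continuous
    convert hq.isLocalHomeomorph j using 1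
    exact funext fun t => proj_fiberLift hp j s' t
  rw [ContinuousAt, ← hl.map_nhds_eq, Filter.tendsto_map'_iff]
  have : (fun z => fiberLift q hp' (i z) (θ _ (s z)) (t z)) ∘ fiberLift q hp j s' =
      fiberLift q hp' j (θ j s') := funext fun t' => key j s' t'
  rw [this]
  simp only [key]
  exact (fiberLift q hp' j (θ j s')).continuous.continuousAt

include hq hp hp' in
/-- An isomorphism of two finite coverings of a union of circles with all components of degree `N`
can be chosen to extend a given partial isomorphism. -/
theorem exists_homeomorph_extending {N : ℕ} [NeZero N] {K : Type*} [TopologicalSpace K] {r : K → B}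
    (hr : IsCoveringMap r) (hfin : ∀ b, (p ⁻¹' {b}).Finite) (hfin' : ∀ b, (p' ⁻¹' {b}).Finite)
    (hcard : ∀ b, Nat.card (p ⁻¹' {b}) = Nat.card (p' ⁻¹' {b}))
    (hfree : ∀ (i : ι) (l : C(ℝ, E)), (∀ t, p (l t) = q i t) → ∀ n : ℤ, l n = l 0 ↔ (N : ℤ) ∣ n)
    (hfree' : ∀ (i : ι) (l : C(ℝ, E')), (∀ t, p' (l t) = q i t) → ∀ n : ℤ, l n = l 0 ↔ (N : ℤ) ∣ n)
    (k : C(K, E)) (k' : C(K, E')) (hk : Function.Injective k) (hk' : Function.Injective k')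
    (hpk : ∀ x, p (k x) = r x) (hpk' : ∀ x, p' (k' x) = r x) :
    ∃ Θ : E ≃ₜ E', (∀ z, p' (Θ z) = p z) ∧ ∀ x, Θ (k x) = k' x := by
  have free : ∀ i s n, (circleMonodromy hq hp i ^ n) s = s ↔ (N : ℤ) ∣ n := by
    intro i s n
    rw [← hfree i _ (proj_fiberLift hp i s) n, circleMonodromy_zpow, fiberLift_zero, Subtype.ext_iff]
    rfl
  have free' : ∀ i s n, (circleMonodromy hq hp' i ^ n) s = s ↔ (N : ℤ) ∣ n := by
    intro i s n
    rw [← hfree' i _ (proj_fiberLift hp' i s) n, circleMonodromy_zpow, fiberLift_zero, Subtype.ext_iff]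
    rfl
  let κ : ∀ i, r ⁻¹' {q i 0} → p ⁻¹' {q i 0} := fun i x => ⟨k x, by
    rw [Set.mem_preimage, hpk]; exact x.2⟩
  let κ' : ∀ i, r ⁻¹' {q i 0} → p' ⁻¹' {q i 0} := fun i x => ⟨k' x, by
    rw [Set.mem_preimage, hpk']; exact x.2⟩
  have hκ : ∀ i x t, k (fiberLift q hr i x t) = fiberLift q hp i (κ i x) t := by
    intro i x t
    have : k.comp (fiberLift q hr i x) = fiberLift q hp i (κ i x) := eq_fiberLift hp
      (by simp [fiberLift_zero, κ]) fun t => by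
        rw [ContinuousMap.comp_apply, hpk, proj_fiberLift hr]
    rw [← this]
    rfl
  have hκ' : ∀ i x t, k' (fiberLift q hr i x t) = fiberLift q hp' i (κ' i x) t := by
    intro i x t
    have : k'.comp (fiberLift q hr i x) = fiberLift q hp' i (κ' i x) := eq_fiberLift hp'
      (by simp [fiberLift_zero, κ']) fun t => by
        rw [ContinuousMap.comp_apply, hpk', proj_fiberLift hr]
    rw [← this]
    rfl
  have hθ : ∀ i, ∃ θ : p ⁻¹' {q i 0} ≃ p' ⁻¹' {q i 0},
      (∀ s, θ (circleMonodromy hq hp i s) = circleMonodromy hq hp' i (θ s)) ∧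
      ∀ x, θ (κ i x) = κ' i x := by
    intro i
    have := (hfin (q i 0)).to_subtype
    have := (hfin' (q i 0)).to_subtype
    refine Equiv.Perm.exists_conj_extending _ _ (circleMonodromy hq hr i) (free i) (free' i)
      (hcard _) _ _ ?_ ?_ ?_ ?_
    · exact fun x y h => Subtype.ext (hk (congrArg Subtype.val h))
    · exact fun x y h => Subtype.ext (hk' (congrArg Subtype.val h))
    · exact fun x => Subtype.ext (hκ i x _)
    · exact fun x => Subtype.ext (hκ' i x _)
  choose θ hθ hθκ using hθ
  obtain ⟨Θ, hΘ⟩ := exists_continuousMap_of_equivariant hq hp hp' (fun i => θ i) hθ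
  obtain ⟨Θ', hΘ'⟩ := exists_continuousMap_of_equivariant hq hp' hp (fun i => (θ i).symm) (by
    intro i s
    rw [Equiv.symm_apply_eq, hθ, Equiv.apply_symm_apply])
  refine ⟨⟨⟨Θ, Θ', fun z => ?_, fun z => ?_⟩, Θ.continuous, Θ'.continuous⟩, fun z => ?_, fun x => ?_⟩
  · obtain ⟨i, s, t, rfl⟩ := exists_eq_fiberLift hq hp z
    rw [hΘ, hΘ', Equiv.symm_apply_apply]
  · obtain ⟨i, s, t, rfl⟩ := exists_eq_fiberLift hq hp' z
    rw [hΘ', hΘ, Equiv.apply_symm_apply]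
  · obtain ⟨i, s, t, rfl⟩ := exists_eq_fiberLift hq hp z
    change p' (Θ _) = _
    rw [hΘ, proj_fiberLift hp', proj_fiberLift hp]
  · obtain ⟨i, s, t, rfl⟩ := exists_eq_fiberLift hq hr x
    change Θ _ = _
    rw [hκ, hΘ, hθκ, hκ']

end CircleFamily

/-! ### Cocycles on paths and their homotopy invariance. -/

/-- The affine segment from `a` to `b`. -/
def affineSegmentMap {W : Type*} [AddCommGroup W] [Module ℝ W] [TopologicalSpace W]
    [ContinuousAdd W] [ContinuousSMul ℝ W] (a b : W) : C(I, W) where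
  toFun t := (1 - (t : ℝ)) • a + (t : ℝ) • b
  continuous_toFun := by fun_prop

/-- An `A`-valued function of paths that is additive along the boundary of each triangle. -/
structure PathCocycle (X : Type*) [TopologicalSpace X] (A : Type*) [AddCommGroup A] where
  val : C(I, X) → A
  triangle : ∀ (F : C(ℝ × ℝ, X)) (a b d : ℝ × ℝ), val (F.comp (affineSegmentMap a b)) +
    val (F.comp (affineSegmentMap b d)) = val (F.comp (affineSegmentMap a d))

namespace PathCocycle

variable {X Y A : Type*} [TopologicalSpace X] [TopologicalSpace Y] [AddCommGroup A]

/-- The pullback of a cocycle. -/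
def comap (c : PathCocycle X A) (g : C(Y, X)) : PathCocycle Y A where
  val γ := c.val (g.comp γ)
  triangle F a b d := c.triangle (g.comp F) a b d

/-- The product of a family of cocycles. -/
def pi {ι : Type*} {A : ι → Type*} [∀ i, AddCommGroup (A i)] (c : ∀ i, PathCocycle X (A i)) :
    PathCocycle X (∀ i, A i) where
  val γ i := (c i).val γ
  triangle F a b d := funext fun i => (c i).triangle F a b d

variable (c : PathCocycle X A)

/-- The value on the part of a real curve between two parameters. -/
def along (F : C(ℝ, X)) (s t : ℝ) : A := c.val (F.comp (affineSegmentMap s t))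

/-- The value on a path. -/
def path {x y : X} (γ : Path x y) : A := c.val γ.toContinuousMap

/-- A degenerate triangle, with all vertices on one line, gives additivity with no reparametrization
of the curve. -/
theorem along_add (F : C(ℝ, X)) (r s t : ℝ) : c.along F r s + c.along F s t = c.along F r t := by
  have h : ∀ s t : ℝ, (F.comp ⟨Prod.fst, continuous_fst⟩).comp
      (affineSegmentMap ((s, 0) : ℝ × ℝ) (t, 0)) = F.comp (affineSegmentMap s t) := by
    intro s t
    ext r
    simp [affineSegmentMap]
  have := c.triangle (F.comp ⟨Prod.fst, continuous_fst⟩) (r, 0) (s, 0) (t, 0)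
  rwa [h, h, h] at this

theorem along_self (F : C(ℝ, X)) (s : ℝ) : c.along F s s = 0 := by
  simpa using c.along_add F s s s

theorem along_congr {F G : C(ℝ, X)} {s t s' t' : ℝ}
    (h : ∀ r : I, F ((1 - (r : ℝ)) * s + r * t) = G ((1 - (r : ℝ)) * s' + r * t')) :
    c.along F s t = c.along G s' t' := by
  unfold along
  congr 1
  ext r
  simpa [affineSegmentMap] using h r

theorem val_const (x : X) : c.val (ContinuousMap.const I x) = 0 := by
  have := c.along_self (ContinuousMap.const ℝ x) 0
  simpa [along, ContinuousMap.const_comp] using this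

theorem square (F : C(ℝ × ℝ, X)) (a b d e : ℝ × ℝ) :
    c.val (F.comp (affineSegmentMap a b)) + c.val (F.comp (affineSegmentMap b e)) =
    c.val (F.comp (affineSegmentMap a d)) + c.val (F.comp (affineSegmentMap d e)) := by
  rw [c.triangle, c.triangle]

theorem path_eq_along {x y : X} (γ : Path x y) {F : C(ℝ, X)} {s t : ℝ}
    (h : ∀ r : I, γ r = F ((1 - (r : ℝ)) * s + r * t)) : c.path γ = c.along F s t := by
  unfold path along
  congr 1
  ext r
  simpa [affineSegmentMap] using h r

theorem path_eq_along_extend {x y : X} (γ : Path x y) :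
    c.path γ = c.along ⟨γ.extend, γ.continuous_extend⟩ 0 1 :=
  c.path_eq_along γ fun r => by simp

theorem path_trans {x y z : X} (γ : Path x y) (δ : Path y z) :
    c.path (γ.trans δ) = c.path γ + c.path δ := by
  rw [c.path_eq_along_extend, ← c.along_add _ 0 (1 / 2) 1]
  congr 1
  · refine (c.path_eq_along γ fun r => ?_).symm
    have hr := r.2
    simp only [ContinuousMap.coe_mk]
    rw [Path.extend_apply _ ⟨by linarith [hr.1], by linarith [hr.2]⟩, Path.trans_apply]
    rw [dif_pos (by simp; linarith [hr.2])]
    congr 1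
    ext
    simp
    ring
  · refine (c.path_eq_along δ fun r => ?_).symm
    have hr := r.2
    simp only [ContinuousMap.coe_mk]
    rw [Path.extend_apply _ ⟨by linarith [hr.1], by linarith [hr.2]⟩, Path.trans_apply]
    split_ifs with h
    · have : r = 0 := by
        ext
        simp only at h
        have := hr.1
        simp only [Set.Icc.coe_zero]
        linarith
      subst this
      simp
    · congr 1
      ext
      simp
      ring

theorem path_symm {x y : X} (γ : Path x y) : c.path γ.symm = - c.path γ := by
  rw [eq_neg_iff_add_eq_zero, add_comm, c.path_eq_along_extend γ, ← c.along_self ⟨γ.extend, γ.continuous_extend⟩ 0,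
    ← c.along_add _ 0 1 0]
  congr 1
  refine c.path_eq_along _ fun r => ?_
  have hr := r.2
  simp only [ContinuousMap.coe_mk]
  rw [Path.extend_apply _ ⟨by linarith [hr.2], by linarith [hr.1]⟩, Path.symm_apply]
  refine congrArg γ (Subtype.ext ?_)
  simp

/-- A homotopy is a square with two constant sides. Cutting it along a diagonal gives two triangles,
and constant paths have value zero. -/
theorem path_eq_of_homotopic {x y : X} {γ δ : Path x y} (h : γ.Homotopic δ) :
    c.path γ = c.path δ := by
  obtain ⟨H⟩ := h
  -- Projecting onto the unit square extends the homotopy to the whole plane, as `triangle` demands.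
  let F : C(ℝ × ℝ, X) := ⟨fun p => H (Set.projIcc 0 1 zero_le_one p.1, Set.projIcc 0 1 zero_le_one p.2),
    by fun_prop⟩
  have h := c.square F (0, 0) (0, 1) (1, 0) (1, 1)
  have h1 : F.comp (affineSegmentMap ((0, 0) : ℝ × ℝ) (0, 1)) = γ.toContinuousMap := by
    ext r
    simp [F, affineSegmentMap]
  have h2 : F.comp (affineSegmentMap ((0, 1) : ℝ × ℝ) (1, 1)) = .const I y := by
    ext r
    simp [F, affineSegmentMap]
  have h3 : F.comp (affineSegmentMap ((0, 0) : ℝ × ℝ) (1, 0)) = .const I x := by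
    ext r
    simp [F, affineSegmentMap]
  have h4 : F.comp (affineSegmentMap ((1, 0) : ℝ × ℝ) (1, 1)) = δ.toContinuousMap := by
    ext r
    simp [F, affineSegmentMap]
  rw [h1, h2, h3, h4, c.val_const, c.val_const, zero_add, add_zero] at h
  exact h

theorem path_refl (x : X) : c.path (Path.refl x) = 0 := c.val_const x

/-- Every point has a neighbourhood whose loops at that point have value zero. -/
def LocallyTrivial : Prop :=
  ∀ x : X, ∃ U ∈ 𝓝 x, ∀ γ : Path x x, Set.range γ ⊆ U → c.path γ = 0

theorem locallyTrivial_of_semilocallySimplyConnected (h : SemilocallySimplyConnected X) :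
    c.LocallyTrivial := by
  intro x
  obtain ⟨U, hU, hγ⟩ := h.exists_nhds x
  exact ⟨U, hU, fun γ hr => by rw [c.path_eq_of_homotopic (hγ γ hr), c.path_refl]⟩

end PathCocycle

/-! ### The principal covering defined by a locally trivial cocycle. -/

/-- Transition data for a principal covering: open sets `U i` around the points `i`, and functions
`m i` on `U i` with locally constant differences. -/
structure TransitionData (V A : Type*) [TopologicalSpace V] [AddCommGroup A] where
  U : V → Set V
  isOpen : ∀ i, IsOpen (U i)
  mem_self : ∀ i, i ∈ U i
  m : V → V → A
  eventually_eq : ∀ i j x, x ∈ U i → x ∈ U j → ∀ᶠ y in 𝓝 x, m i y - m j y = m i x - m j x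

/-- The total space of the principal covering with given transition data. -/
@[ext]
structure PrincipalCover {V A : Type*} [TopologicalSpace V] [AddCommGroup A]
    (D : TransitionData V A) where
  base : V
  coord : A

namespace PrincipalCover

variable {V A : Type*} [TopologicalSpace V] [AddCommGroup A] (D : TransitionData V A)

instance : TopologicalSpace (PrincipalCover D) :=
  ⨆ (i : V) (a : A), TopologicalSpace.coinduced (fun y : D.U i => ⟨y, a + D.m i y⟩) inferInstance

variable {D}

theorem isOpen_iff {G : Set (PrincipalCover D)} :
    IsOpen G ↔ ∀ i a, IsOpen {y | y ∈ D.U i ∧ (⟨y, a + D.m i y⟩ : PrincipalCover D) ∈ G} := by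
  simp only [isOpen_iSup_iff, isOpen_coinduced]
  refine forall₂_congr fun i a => ?_
  rw [(D.isOpen i).isOpenEmbedding_subtypeVal.isOpen_iff_image_isOpen]
  congr! 1
  ext y
  simp [and_comm]

theorem continuous_base : Continuous (base : PrincipalCover D → V) := by
  refine ⟨fun G hG => isOpen_iff.2 fun i a => ?_⟩
  exact (D.isOpen i).inter hG

theorem isOpenMap_base : IsOpenMap (base : PrincipalCover D → V) := by
  intro G hG
  have : base '' G = ⋃ (i) (a), {y | y ∈ D.U i ∧ (⟨y, a + D.m i y⟩ : PrincipalCover D) ∈ G} := by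
    ext y
    simp only [Set.mem_image, Set.mem_iUnion, Set.mem_ofPred_eq]
    constructor
    · rintro ⟨z, hz, rfl⟩
      refine ⟨z.base, z.coord - D.m z.base z.base, D.mem_self _, ?_⟩
      simpa using hz
    · rintro ⟨i, a, -, h⟩
      exact ⟨_, h, rfl⟩
  rw [this]
  exact isOpen_iUnion fun i => isOpen_iUnion fun a => isOpen_iff.1 hG i a

/-- The sheets of the principal covering. -/
def sheet (i : V) (a : A) : Set (PrincipalCover D) := {z | z.base ∈ D.U i ∧ z.coord - D.m i z.base = a}

/-- A sheet is open because `m j - m i` is locally constant on overlaps: a local section for `j`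
that meets a sheet for `i` stays in it nearby. -/
theorem isSheets (i : V) : IsSheets (base : PrincipalCover D → V) (D.U i) (sheet i) where
  isOpen_base := D.isOpen i
  isOpen a := by
    refine isOpen_iff.2 fun j b => ?_
    rw [isOpen_iff_mem_nhds]
    rintro y ⟨hj, hi, h⟩
    filter_upwards [D.eventually_eq j i y hj hi, (D.isOpen i).mem_nhds hi, (D.isOpen j).mem_nhds hj]
      with y' h1 h2 h3
    refine ⟨h3, h2, ?_⟩
    simp only at h ⊢
    rw [← h, add_sub_assoc, h1, add_sub_assoc]
  mem_base a z hz := hz.1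
  exists_lift a b hb := ⟨⟨b, a + D.m i b⟩, ⟨hb, by simp⟩, rfl⟩
  inj a z hz z' hz' h := by
    refine PrincipalCover.ext h ?_
    have := hz.2.trans hz'.2.symm
    rw [h] at this
    exact sub_left_injective this
  cover z hz := ⟨_, hz, rfl⟩
  disj z a b ha hb := ha.2.symm.trans hb.2

theorem isCoveringMap : IsCoveringMap (base : PrincipalCover D → V) :=
  isCoveringMap_of_isSheets continuous_base isOpenMap_base fun b =>
    ⟨D.U b, A, sheet b, D.mem_self b, isSheets b⟩

theorem continuousAt_iff_of_mem {T : Type*} [TopologicalSpace T] {f : T → PrincipalCover D} {t : T}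
    (hf : ContinuousAt (fun t => (f t).base) t) {i : V} (hi : (f t).base ∈ D.U i) :
    ContinuousAt f t ↔ ∀ᶠ t' in 𝓝 t, (f t').coord - D.m i (f t').base =
      (f t).coord - D.m i (f t).base := by
  constructor
  · intro h
    have := h.preimage_mem_nhds (((isSheets i).isOpen ((f t).coord - D.m i (f t).base)).mem_nhds
      ⟨hi, rfl⟩)
    filter_upwards [this] with t' ht'
    exact ht'.2
  · intro h
    refine continuousAt_of_isSheets isOpenMap_base (isSheets i) hf (s := (f t).coord - D.m i (f t).base) ?_
    filter_upwards [h, hf.preimage_mem_nhds ((D.isOpen i).mem_nhds hi)] with t' h1 h2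
    exact ⟨h2, h1⟩

end PrincipalCover

namespace PathCocycle

variable {V A : Type*} [TopologicalSpace V] [AddCommGroup A]

/-- Transition data adapted to a cocycle. -/
structure IsAdapted (c : PathCocycle V A) (D : TransitionData V A) : Prop where
  eq_add : ∀ i x y (δ : Path x y), Set.range δ ⊆ D.U i → D.m i y = D.m i x + c.path δ

/-- On a path-connected neighbourhood where the cocycle has no periods it has a primitive `m i`,
given by its value on any path from the centre `i`. Two primitives change by the same amount along a
path in an overlap, so their difference is constant near each point. -/
theorem exists_isAdapted [LocallyPathConnectedSpace V] (c : PathCocycle V A)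
    (hc : c.LocallyTrivial) : ∃ D : TransitionData V A, c.IsAdapted D := by
  have h1 : ∀ x : V, ∃ U : Set V, IsOpen U ∧ x ∈ U ∧ IsPathConnected U ∧
      ∀ γ : Path x x, Set.range γ ⊆ U → c.path γ = 0 := by
    intro x
    obtain ⟨U, hU, hγ⟩ := hc x
    obtain ⟨W, hWU, hW, hxW⟩ := mem_nhds_iff.1 hU
    refine ⟨pathComponentIn W x, hW.pathComponentIn x, mem_pathComponentIn_self hxW,
      isPathConnected_pathComponentIn hxW, fun γ h => hγ γ ?_⟩
    exact h.trans (pathComponentIn_subset.trans hWU)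
  choose U hUo hxU hUc hU using h1
  have h2 : ∀ i y, ∃ a : A, ∀ γ : Path i y, Set.range γ ⊆ U i → c.path γ = a := by
    intro i y
    by_cases h : ∃ γ : Path i y, Set.range γ ⊆ U i
    · obtain ⟨γ, hγ⟩ := h
      refine ⟨c.path γ, fun δ hδ => ?_⟩
      have := hU i (δ.trans γ.symm) (by
        rw [Path.trans_range, Path.symm_range]
        exact Set.union_subset hδ hγ)
      rwa [path_trans, path_symm, ← sub_eq_add_neg, sub_eq_zero] at this
    -- Such a `y` lies outside the path-connected set `U i`, where the value of `m i` is irrelevant.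
    · push Not at h
      exact ⟨0, fun γ hγ => absurd hγ (h γ)⟩
  choose m hm using h2
  have key : ∀ i x y (δ : Path x y), Set.range δ ⊆ U i → m i y = m i x + c.path δ := by
    intro i x y δ hδ
    obtain hx : x ∈ U i := hδ ⟨0, δ.source⟩
    have hj := (hUc i).joinedIn i (hxU i) x hx
    have hr : Set.range hj.somePath ⊆ U i := by
      rintro _ ⟨t, rfl⟩
      exact hj.somePath_mem t
    rw [← hm i x hj.somePath hr, ← hm i y (hj.somePath.trans δ), path_trans]
    rw [Path.trans_range]
    exact Set.union_subset hr hδ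
  refine ⟨⟨U, hUo, hxU, m, fun i j x hi hj => ?_⟩, ⟨key⟩⟩
  have hW : pathComponentIn (U i ∩ U j) x ∈ 𝓝 x :=
    (((hUo i).inter (hUo j)).pathComponentIn x).mem_nhds (mem_pathComponentIn_self ⟨hi, hj⟩)
  filter_upwards [hW] with y hy
  have hr : Set.range (JoinedIn.somePath hy) ⊆ U i ∩ U j := by
    rintro _ ⟨t, rfl⟩
    exact JoinedIn.somePath_mem hy t
  rw [key i x y hy.somePath (hr.trans Set.inter_subset_left),
    key j x y hy.somePath (hr.trans Set.inter_subset_right)]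
  abel

variable {c : PathCocycle V A} {D : TransitionData V A}

/-- Monodromy is translation by the values of the cocycle: the coordinate and the integral of the
cocycle along the curve both change by differences of the primitive, so their difference is locally
constant on ℝ. -/
theorem IsAdapted.coord_sub (h : c.IsAdapted D) (l : C(ℝ, PrincipalCover D)) (F : C(ℝ, V))
    (hF : ∀ t, (l t).base = F t) (s t : ℝ) : (l t).coord - (l s).coord = c.along F s t := by
  have hloc : IsLocallyConstant fun t => (l t).coord - c.along F 0 t := by
    rw [IsLocallyConstant.iff_eventually_eq]
    intro t₀
    have h1 := (PrincipalCover.continuousAt_iff_of_mem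
      (PrincipalCover.continuous_base.comp l.continuous).continuousAt (D.mem_self (l t₀).base)).1
      (l.continuous.continuousAt (x := t₀))
    have h2 := F.continuous.continuousAt.preimage_mem_nhds
      ((D.isOpen (l t₀).base).mem_nhds (by rw [← hF]; exact D.mem_self _))
    obtain ⟨ε, hε, hball⟩ := Metric.mem_nhds_iff.1 h2
    filter_upwards [h1, Metric.ball_mem_nhds t₀ hε] with t ht htε
    let δ : Path (F t₀) (F t) :=
      { toFun := fun r => F ((1 - (r : ℝ)) * t₀ + r * t)
        continuous_toFun := by fun_prop
        source' := by simp
        target' := by simp }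
    have hδ : Set.range δ ⊆ D.U (l t₀).base := by
      rintro _ ⟨r, rfl⟩
      refine hball ?_
      have := (convex_ball t₀ ε) (Metric.mem_ball_self hε) htε (a := 1 - (r : ℝ)) (b := r)
        (by linarith [r.2.2]) r.2.1 (by ring)
      simpa using this
    have h3 := h.eq_add _ _ _ δ hδ
    rw [c.path_eq_along δ (fun r => rfl)] at h3
    rw [← c.along_add F 0 t₀ t]
    rw [hF] at h3
    rw [hF, hF, h3] at ht
    have : (l t).coord = (l t).coord - (D.m (F t₀) (F t₀) + c.along F t₀ t) + (D.m (F t₀) (F t₀) + c.along F t₀ t) := by abel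
    rw [this, ht]
    abel
  have := hloc.apply_eq_of_preconnectedSpace s t
  rw [← c.along_add F 0 s t] at this
  have h' : (l t).coord - (l s).coord = ((l t).coord - (c.along F 0 s + c.along F s t)) -
    ((l s).coord - c.along F 0 s) + c.along F s t := by abel
  rw [h', ← this]
  simp

/-- A homotopy between two maps shifts the coordinate of the principal covering continuously. -/
theorem IsAdapted.continuous_shift (h : c.IsAdapted D) {E : Type*} [TopologicalSpace E]
    [LocallyPathConnectedSpace E] (f g : C(E, V)) (k : E → A)
    (hk : ∀ {x y : E} (δ : Path x y),
      c.path (δ.map f.continuous) + k y = k x + c.path (δ.map g.continuous)) :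
    Continuous fun z : Function.Pullback f (PrincipalCover.base : PrincipalCover D → V) =>
      (⟨g z.1.1, z.1.2.coord + k z.1.1⟩ : PrincipalCover D) := by
  rw [continuous_iff_continuousAt]
  rintro ⟨⟨x₀, w₀⟩, hw₀⟩
  refine (PrincipalCover.continuousAt_iff_of_mem (by fun_prop) (D.mem_self _)).2 ?_
  have hw := (PrincipalCover.continuousAt_iff_of_mem (f := fun z :
    Function.Pullback f (PrincipalCover.base : PrincipalCover D → V) => z.1.2) (t := ⟨⟨x₀, w₀⟩, hw₀⟩)
    (PrincipalCover.continuous_base.comp (by fun_prop)).continuousAt (D.mem_self _)).1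
    (by fun_prop)
  -- Along paths inside `W` both primitives compute the cocycle on the two image paths, and `hk`
  -- says that the change of `k` makes up the difference.
  let W := f ⁻¹' D.U w₀.base ∩ g ⁻¹' D.U (g x₀)
  have hWo : IsOpen W := ((D.isOpen _).preimage f.continuous).inter ((D.isOpen _).preimage g.continuous)
  have hxW : x₀ ∈ W := ⟨by
    change f x₀ ∈ D.U w₀.base
    rw [show f x₀ = w₀.base from hw₀]
    exact D.mem_self _, D.mem_self _⟩
  have hW : pathComponentIn W x₀ ∈ 𝓝 x₀ :=
    (hWo.pathComponentIn x₀).mem_nhds (mem_pathComponentIn_self hxW)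
  have hfst : ContinuousAt (fun z : Function.Pullback f (PrincipalCover.base : PrincipalCover D → V) =>
    z.1.1) ⟨⟨x₀, w₀⟩, hw₀⟩ := by fun_prop
  filter_upwards [hw, hfst.preimage_mem_nhds hW] with z h1 (h2 : JoinedIn W x₀ z.1.1)
  have hr : ∀ t, h2.somePath t ∈ W := fun t => h2.somePath_mem t
  have e1 := h.eq_add w₀.base _ _ (h2.somePath.map f.continuous) (by
    rintro _ ⟨t, rfl⟩
    exact (hr t).1)
  have e2 := h.eq_add (g x₀) _ _ (h2.somePath.map g.continuous) (by
    rintro _ ⟨t, rfl⟩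
    exact (hr t).2)
  have e3 := hk h2.somePath
  have hz : f z.1.1 = z.1.2.base := z.2
  have hw₀' : f x₀ = w₀.base := hw₀
  have h1' : z.1.2.coord - D.m w₀.base (f z.1.1) = w₀.coord - D.m w₀.base (f x₀) := by
    rw [hz, hw₀']
    exact h1
  rw [e1] at h1'
  rw [e2]
  have e4 : k z.1.1 = k x₀ + c.path (h2.somePath.map g.continuous) - c.path (h2.somePath.map f.continuous) := by
    rw [← e3]; abel
  have e5 : z.1.2.coord = w₀.coord - D.m w₀.base (f x₀) + (D.m w₀.base (f x₀) + c.path (h2.somePath.map f.continuous)) := by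
    rw [← h1']; abel
  change z.1.2.coord + k z.1.1 - _ = w₀.coord + k x₀ - D.m (g x₀) (g x₀)
  rw [e4, e5]
  abel

end PathCocycle

/-! ### First singular homology inside one-chains modulo boundaries. -/

section SingularChains

open CategoryTheory AlgebraicTopology Simplicial Opposite

/-- The coefficient group `ℤ`. -/
abbrev intCoeff : AddCommGrpCat.{u} := AddCommGrpCat.of (ULift.{u} ℤ)

/-- The integral singular chain complex. -/
noncomputable abbrev singularChains (X : Type u) [TopologicalSpace X] :
    ChainComplex AddCommGrpCat.{u} ℕ :=
  (TopCat.toSSet.obj (TopCat.of X)).chainComplex intCoeff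

variable {X Y : Type u} [TopologicalSpace X] [TopologicalSpace Y]

/-- The `n`-simplex of the singular set given by a continuous map. -/
noncomputable def singularSimplex (n : ℕ) (τ : C(stdSimplex ℝ (Fin (n + 1)), X)) :
    (TopCat.toSSet.obj (TopCat.of X)) _⦋n⦌ :=
  ((TopCat.of X).toSSetObjEquiv (op ⦋n⦌)).symm τ

theorem exists_eq_singularSimplex (n : ℕ) (s : (TopCat.toSSet.obj (TopCat.of X)) _⦋n⦌) :
    ∃ τ : C(stdSimplex ℝ (Fin (n + 1)), X), s = singularSimplex n τ :=
  ⟨_, (((TopCat.of X).toSSetObjEquiv (op ⦋n⦌)).symm_apply_apply s).symm⟩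

theorem delta_singularSimplex (n : ℕ) (i : Fin (n + 2)) (τ : C(stdSimplex ℝ (Fin (n + 2)), X)) :
    (TopCat.toSSet.obj (TopCat.of X)).δ i (singularSimplex (n + 1) τ) =
      singularSimplex n (τ.comp ⟨stdSimplex.map i.succAbove, stdSimplex.continuous_map _⟩) := rfl

/-- The chain given by a singular simplex. -/
noncomputable def simplexChain (n : ℕ) (τ : C(stdSimplex ℝ (Fin (n + 1)), X)) :
    (singularChains X).X n :=
  (SSet.ιChainComplex (R := intCoeff) _ (singularSimplex n τ)).hom (ULift.up 1)

theorem d_simplexChain (n : ℕ) (τ : C(stdSimplex ℝ (Fin (n + 2)), X)) :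
    ((singularChains X).d (n + 1) n).hom (simplexChain (n + 1) τ) = ∑ i : Fin (n + 2),
      (-1) ^ i.val • simplexChain n (τ.comp ⟨stdSimplex.map i.succAbove, stdSimplex.continuous_map _⟩) := by
  have h := SSet.ιChainComplex_d (TopCat.toSSet.obj (TopCat.of X)) intCoeff (singularSimplex (n + 1) τ)
  have h' := congrArg (fun f => f.hom (ULift.up 1)) h
  simp only [delta_singularSimplex] at h'
  refine Eq.trans h' ?_
  let ev : (intCoeff ⟶ (singularChains X).X n) →+ (singularChains X).X n :=
    { toFun := fun f => f.hom (ULift.up 1)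
      map_zero' := rfl
      map_add' := fun f g => rfl }
  change ev _ = _
  rw [map_sum]
  refine Finset.sum_congr rfl fun i _ => ?_
  rw [map_zsmul]
  rfl

theorem map_simplexChain (g : C(X, Y)) (n : ℕ) (τ : C(stdSimplex ℝ (Fin (n + 1)), X)) :
    ((SSet.chainComplexMap (TopCat.toSSet.map (TopCat.ofHom g)) intCoeff).f n).hom (simplexChain n τ) =
      simplexChain n (g.comp τ) := by
  have h := SSet.ι_chainComplexMap_f _ _ (TopCat.toSSet.map (TopCat.ofHom g)) intCoeff (singularSimplex n τ)
  exact congrArg (fun f => f.hom (ULift.up 1)) h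

theorem chains_hom_ext (n : ℕ) {T : AddCommGrpCat.{u}} {f g : (singularChains X).X n ⟶ T}
    (h : ∀ τ, f.hom (simplexChain n τ) = g.hom (simplexChain n τ)) : f = g := by
  refine SSet.chainComplex_hom_ext fun s => ?_
  obtain ⟨τ, rfl⟩ := exists_eq_singularSimplex n s
  ext ⟨m⟩
  have hm : (ULift.up m : ULift.{u} ℤ) = m • ULift.up 1 := by
    ext
    simp
  have key : ∀ f : (singularChains X).X n ⟶ T,
      (SSet.ιChainComplex _ (singularSimplex n τ) ≫ f).hom (ULift.up m) = m • f.hom (simplexChain n τ) := by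
    intro f
    rw [hm, map_zsmul]
    rfl
  rw [key, key, h]

theorem exists_hom_chains (n : ℕ) {T : AddCommGrpCat.{u}} 
    (φ : C(stdSimplex ℝ (Fin (n + 1)), X) → T) :
    ∃ f : (singularChains X).X n ⟶ T, ∀ τ, f.hom (simplexChain n τ) = φ τ := by
  let ψ (a : T) : intCoeff ⟶ T := AddCommGrpCat.ofHom
    ((zmultiplesHom T a).comp (AddEquiv.ulift (α := ℤ)).toAddMonoidHom)
  let f : (singularChains X).X n ⟶ T := Limits.Sigma.desc fun s =>
    ψ (φ ((TopCat.of X).toSSetObjEquiv (op ⦋n⦌) s))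
  refine ⟨f, fun τ => ?_⟩
  have h : SSet.ιChainComplex _ (singularSimplex n τ) ≫ f = ψ (φ τ) := by
    refine (Limits.Sigma.ι_desc _ _).trans ?_
    congr 2
  refine (congrArg (fun f => f.hom (ULift.up 1)) h).trans ?_
  simp only [ψ, AddCommGrpCat.hom_ofHom, AddMonoidHom.comp_apply, zmultiplesHom_apply]
  exact one_zsmul _

/-- The class modulo boundaries of a singular `1`-simplex, viewed as a path. -/
noncomputable def pathClass (γ : C(I, X)) : (singularChains X).opcycles 1 :=
  ((singularChains X).pOpcycles 1).hom
    (simplexChain 1 (γ.comp (stdSimplexHomeomorphUnitInterval : C(stdSimplex ℝ (Fin 2), I))))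

theorem opcycles_hom_ext {T : AddCommGrpCat.{u}} {f g : (singularChains X).opcycles 1 ⟶ T}
    (h : ∀ γ, f.hom (pathClass γ) = g.hom (pathClass γ)) : f = g := by
  rw [← cancel_epi ((singularChains X).pOpcycles 1)]
  refine chains_hom_ext 1 fun τ => ?_
  have := h (τ.comp (stdSimplexHomeomorphUnitInterval.symm : C(I, stdSimplex ℝ (Fin 2))))
  have hτ : (τ.comp (stdSimplexHomeomorphUnitInterval.symm : C(I, stdSimplex ℝ (Fin 2)))).comp
      (stdSimplexHomeomorphUnitInterval : C(stdSimplex ℝ (Fin 2), I)) = τ := by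
    ext z
    simp
  rw [pathClass, hτ] at this
  exact this

/-- The classes of paths generate: the quotient map by `S` kills all of them and is therefore zero.
-/
theorem mem_of_pathClass_mem (S : AddSubgroup ((singularChains X).opcycles 1))
    (h : ∀ γ, pathClass γ ∈ S) (z : (singularChains X).opcycles 1) : z ∈ S := by
  have : AddCommGrpCat.ofHom (QuotientAddGroup.mk' S) = AddCommGrpCat.ofHom 0 := by
    refine opcycles_hom_ext fun γ => ?_
    exact (QuotientAddGroup.eq_zero_iff _).2 (h γ)
  have h' := congrArg (fun f => f.hom z) this
  exact (QuotientAddGroup.eq_zero_iff _).1 h'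

/-- The affine map from the standard triangle with given vertices. -/
def affineTriangle (a b d : ℝ × ℝ) : C(stdSimplex ℝ (Fin 3), ℝ × ℝ) where
  toFun z := z.1 0 • a + z.1 1 • b + z.1 2 • d
  continuous_toFun := by
    have h : ∀ i : Fin 3, Continuous fun z : stdSimplex ℝ (Fin 3) => z.1 i := fun i =>
      (continuous_apply i).comp continuous_subtype_val
    exact (((h 0).smul continuous_const).add ((h 1).smul continuous_const)).add
      ((h 2).smul continuous_const)

theorem affineTriangle_comp_face (a : Fin 3 → ℝ × ℝ) (i : Fin 3) :
    (affineTriangle (a 0) (a 1) (a 2)).comp ⟨stdSimplex.map i.succAbove, stdSimplex.continuous_map _⟩ =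
      (affineSegmentMap (a (i.succAbove 0)) (a (i.succAbove 1))).comp
        (stdSimplexHomeomorphUnitInterval : C(stdSimplex ℝ (Fin 2), I)) := by
  ext1 z
  have hz : z.1 0 = 1 - z.1 1 := by
    have := z.2.2
    rw [Fin.sum_univ_two] at this
    linarith
  have h1 : ((stdSimplexHomeomorphUnitInterval z : I) : ℝ) = z.1 1 := rfl
  have h2 : ∀ j, (stdSimplex.map i.succAbove z).1 j = ∑ k with i.succAbove k = j, z.1 k := fun j =>
    FunOnFinite.linearMap_apply_apply ℝ ℝ _ _ _
  simp only [affineTriangle, affineSegmentMap, ContinuousMap.comp_apply, ContinuousMap.coe_mk,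
    h1, h2, Finset.sum_filter, Fin.sum_univ_two]
  fin_cases i <;> simp [Fin.succAbove, hz]

/-- The universal cocycle, with values in singular chains modulo boundaries. -/
noncomputable def pathClassCocycle (X : Type u) [TopologicalSpace X] :
    PathCocycle X ((singularChains X).opcycles 1) where
  val := pathClass
  triangle F a b d := by
    have h := d_simplexChain 1 (F.comp (affineTriangle a b d))
    have hd := congrArg (fun f => f.hom (simplexChain 2 (F.comp (affineTriangle a b d))))
      ((singularChains X).d_pOpcycles 2 1)
    have hd' : ((singularChains X).pOpcycles 1).hom (((singularChains X).d 2 1).hom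
      (simplexChain 2 (F.comp (affineTriangle a b d)))) = 0 := hd
    have h3 : ∀ i : Fin 3, (F.comp (affineTriangle a b d)).comp
        ⟨stdSimplex.map i.succAbove, stdSimplex.continuous_map _⟩ =
        (F.comp (affineSegmentMap (![a, b, d] (i.succAbove 0)) (![a, b, d] (i.succAbove 1)))).comp
        (stdSimplexHomeomorphUnitInterval : C(stdSimplex ℝ (Fin 2), I)) := fun i => by
      rw [ContinuousMap.comp_assoc, ContinuousMap.comp_assoc,
        ← affineTriangle_comp_face ![a, b, d] i]
      rfl
    rw [h, map_sum] at hd'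
    simp only [map_zsmul, h3] at hd'
    have e := (Fin.sum_univ_three _).symm.trans hd'
    -- The faces opposite `a`, `b`, `d` are the segments `bd`, `ad`, `ab`, with signs +, -, +.
    change (1 : ℤ) • pathClass (F.comp (affineSegmentMap b d)) +
      ((-1) ^ 1 : ℤ) • pathClass (F.comp (affineSegmentMap a d)) +
      ((-1) ^ 2 : ℤ) • pathClass (F.comp (affineSegmentMap a b)) = 0 at e
    simp only [one_smul, pow_one, neg_smul, even_two, Even.neg_pow, one_pow] at e
    rw [← sub_eq_zero, ← e]
    abel

/-- The `0`-chain of a point. -/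
noncomputable def pointChain (x : X) : (singularChains X).X 0 := simplexChain 0 (.const _ x)

/-- The boundary of a class of chains modulo boundaries. -/
noncomputable def classBoundary (X : Type u) [TopologicalSpace X] :
    (singularChains X).opcycles 1 →+ (singularChains X).X 0 :=
  ((singularChains X).fromOpcycles 1 0).hom

theorem classBoundary_pathClass (γ : C(I, X)) :
    classBoundary X (pathClass γ) = pointChain (γ 1) - pointChain (γ 0) := by
  have h0 := congrArg (fun f => f.hom (simplexChain 1 (γ.comp
    (stdSimplexHomeomorphUnitInterval : C(stdSimplex ℝ (Fin 2), I)))))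
    ((singularChains X).p_fromOpcycles 1 0)
  have h1 : classBoundary X (pathClass γ) = ((singularChains X).d 1 0).hom (simplexChain 1 (γ.comp
    (stdSimplexHomeomorphUnitInterval : C(stdSimplex ℝ (Fin 2), I)))) := h0
  have hz : ∀ z : stdSimplex ℝ (Fin 1), z.1 0 = 1 := fun z => by
    have := z.2.2
    rwa [Fin.sum_univ_one] at this
  have h2 : ∀ (i : Fin 2) (z : stdSimplex ℝ (Fin 1)),
      ((stdSimplexHomeomorphUnitInterval (stdSimplex.map i.succAbove z) : I) : ℝ) =
        ∑ k with i.succAbove k = 1, z.1 k := fun i z => FunOnFinite.linearMap_apply_apply ℝ ℝ _ _ _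
  have h3 : (γ.comp (stdSimplexHomeomorphUnitInterval : C(stdSimplex ℝ (Fin 2), I))).comp
      ⟨stdSimplex.map (0 : Fin 2).succAbove, stdSimplex.continuous_map _⟩ =
      ContinuousMap.const (stdSimplex ℝ (Fin 1)) (γ 1) := by
    ext1 z
    refine congrArg γ (Subtype.ext ((h2 0 z).trans ?_))
    simp [Finset.sum_filter, hz]
  have h4 : (γ.comp (stdSimplexHomeomorphUnitInterval : C(stdSimplex ℝ (Fin 2), I))).comp
      ⟨stdSimplex.map (1 : Fin 2).succAbove, stdSimplex.continuous_map _⟩ =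
      ContinuousMap.const (stdSimplex ℝ (Fin 1)) (γ 0) := by
    ext1 z
    refine congrArg γ (Subtype.ext ((h2 1 z).trans ?_))
    simp [Finset.sum_filter, Fin.succAbove]
  rw [h1, d_simplexChain]
  refine (Fin.sum_univ_two _).trans ?_
  rw [h3, h4]
  change (1 : ℤ) • pointChain (γ 1) + ((-1) ^ 1 : ℤ) • pointChain (γ 0) = _
  rw [one_smul, pow_one, neg_smul, one_smul, sub_eq_add_neg]

theorem exists_boundary_hom {T : Type u} [AddCommGroup T] (g : X → T) :
    ∃ G : (singularChains X).X 0 →+ T, ∀ x, G (pointChain x) = g x := by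
  obtain ⟨f, hf⟩ := exists_hom_chains (X := X) 0 (T := AddCommGrpCat.of T)
    fun τ => g (τ default)
  exact ⟨f.hom, fun x => hf _⟩

/-- The inclusion of the first homology group into chains modulo boundaries. -/
noncomputable def homologyToClasses (X : Type u) [TopologicalSpace X] :
    singularH1.obj (TopCat.of X) →+ (singularChains X).opcycles 1 :=
  ((singularChains X).homologyι 1).hom

theorem homologyToClasses_injective : Function.Injective (homologyToClasses X) :=
  (AddCommGrpCat.mono_iff_injective ((singularChains X).homologyι 1)).1 inferInstance

theorem classBoundary_homologyToClasses (z : singularH1.obj (TopCat.of X)) :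
    classBoundary X (homologyToClasses X z) = 0 :=
  congrArg (fun f => f.hom z) ((singularChains X).homologyι_comp_fromOpcycles 1 0)

/-- First homology is the kernel of the boundary map on one-chains modulo boundaries. -/
theorem exists_homologyToClasses_eq {z : (singularChains X).opcycles 1} (h : classBoundary X z = 0) :
    ∃ w, homologyToClasses X w = z := by
  have hex := ShortComplex.exact_of_f_is_kernel
    (ShortComplex.mk _ _ ((singularChains X).homologyι_comp_fromOpcycles 1 0))
    ((singularChains X).homologyIsKernel 1 0 (by simp))
  rw [ShortComplex.ab_exact_iff] at hex
  exact hex z h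

/-- The map induced on chains modulo boundaries. -/
noncomputable def classMap (g : C(X, Y)) :
    (singularChains X).opcycles 1 →+ (singularChains Y).opcycles 1 :=
  (HomologicalComplex.opcyclesMap
    (SSet.chainComplexMap (TopCat.toSSet.map (TopCat.ofHom g)) intCoeff) 1).hom

theorem classMap_pathClass (g : C(X, Y)) (γ : C(I, X)) :
    classMap g (pathClass γ) = pathClass (g.comp γ) := by
  have h := congrArg (fun f => f.hom (simplexChain 1 (γ.comp
    (stdSimplexHomeomorphUnitInterval : C(stdSimplex ℝ (Fin 2), I))))) (HomologicalComplex.p_opcyclesMap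
    (SSet.chainComplexMap (TopCat.toSSet.map (TopCat.ofHom g)) intCoeff) 1)
  refine Eq.trans h ?_
  exact congrArg ((singularChains Y).pOpcycles 1).hom (map_simplexChain g 1 _)

theorem homologyToClasses_map (g : C(X, Y)) (z : singularH1.obj (TopCat.of X)) :
    homologyToClasses Y (singularH1Map g z) = classMap g (homologyToClasses X z) :=
  congrArg (fun f => f.hom z) (HomologicalComplex.homologyι_naturality
    (SSet.chainComplexMap (TopCat.toSSet.map (TopCat.ofHom g)) intCoeff) 1)

end SingularChains

/-! ### The homology of a circle and the cocycle attached to an edge. -/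

namespace PathCocycle

variable {X A : Type*} [TopologicalSpace X] [AddCommGroup A] (c : PathCocycle X A)

theorem along_shift (F : C(ℝ, X)) (hF : ∀ (t : ℝ) (n : ℤ), F (t + n) = F t) (s t : ℝ) (n : ℤ) :
    c.along F (s + n) (t + n) = c.along F s t :=
  c.along_congr fun r => by
    rw [← hF ((1 - (r : ℝ)) * s + r * t) n]
    ring_nf

theorem along_int (F : C(ℝ, X)) (hF : ∀ (t : ℝ) (n : ℤ), F (t + n) = F t) (n : ℤ) :
    c.along F 0 n = n • c.along F 0 1 := by
  have h1 : ∀ n : ℤ, c.along F n ((n + 1 : ℤ) : ℝ) = c.along F 0 1 := by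
    intro n
    have := c.along_shift F hF 0 1 n
    rw [← this]
    push_cast
    ring_nf
  induction n with
  | zero => simp [c.along_self]
  | succ n ih => rw [← c.along_add F 0 (n : ℤ), h1, ih, add_zsmul, one_zsmul]
  | pred n ih =>
    have h2 := h1 (-n - 1)
    rw [sub_add_cancel] at h2
    rw [← c.along_add F 0 ((-n - 1 : ℤ) : ℝ), h2] at ih
    rw [sub_zsmul, one_zsmul, ← ih, add_neg_cancel_right]

/-- In ℝ the lifted path is homotopic to the straight segment between its ends. -/
theorem path_eq_along_of_lift (q : C(ℝ, X)) (γ : C(I, X)) (γ' : C(I, ℝ)) (h : q.comp γ' = γ) :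
    c.val γ = c.along q (γ' 0) (γ' 1) := by
  let δ : Path (γ' 0) (γ' 1) := ⟨γ', rfl, rfl⟩
  let δ' : Path (γ' 0) (γ' 1) := ⟨affineSegmentMap (γ' 0) (γ' 1), by simp [affineSegmentMap],
    by simp [affineSegmentMap]⟩
  have := (c.comap q).path_eq_of_homotopic (SimplyConnectedSpace.paths_homotopic δ δ')
  rw [← h]
  exact this

end PathCocycle

/-- The map `q` identifies a space with the circle `ℝ ⧸ ℤ`. -/
structure IsCircleCover {e : Type*} [TopologicalSpace e] (q : C(ℝ, e)) : Prop where
  isCoveringMap : IsCoveringMap q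
  surjective : Function.Surjective q
  eq_iff : ∀ s t, q s = q t ↔ ∃ n : ℤ, s = t + n

theorem IsCircleCover.add_int {e : Type*} [TopologicalSpace e] {q : C(ℝ, e)} (hq : IsCircleCover q)
    (t : ℝ) (n : ℤ) : q (t + n) = q t := (hq.eq_iff _ _).2 ⟨n, rfl⟩

theorem exists_isCircleCover {e : Type*} [TopologicalSpace e] (φ : e ≃ₜ Circle) :
    ∃ q : C(ℝ, e), IsCircleCover q := by
  have hπ : (2 * Real.pi) ≠ 0 := by positivity
  let m : ℝ ≃ₜ ℝ := Homeomorph.mulLeft₀ (2 * Real.pi) hπ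
  refine ⟨⟨fun t => φ.symm (Circle.exp (m t)), by fun_prop⟩, ?_, ?_, ?_⟩
  · exact (Circle.isCoveringMap_exp.comp_homeomorph m).homeomorph_comp φ.symm
  · exact φ.symm.surjective.comp (Circle.exp_surjective.comp m.surjective)
  · intro s t
    simp only [ContinuousMap.coe_mk, EmbeddingLike.apply_eq_iff_eq, Circle.exp_eq_exp]
    refine exists_congr fun n => ?_
    simp only [m, Homeomorph.coe_mulLeft₀]
    constructor
    · intro h
      have : 2 * Real.pi * s = 2 * Real.pi * (t + n) := by rw [h]; ring
      exact mul_left_cancel₀ hπ this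
    · rintro rfl
      ring

section

variable {e : Type u} [TopologicalSpace e] {q : C(ℝ, e)}

/-- The first homology of a circle is generated by the fundamental loop. -/
theorem IsCircleCover.mem_zmultiples (hq : IsCircleCover q) {z : (singularChains e).opcycles 1}
    (hz : classBoundary e z = 0) :
    z ∈ AddSubgroup.zmultiples ((pathClassCocycle e).along q 0 1) := by
  set c := pathClassCocycle e
  choose s hs using hq.surjective
  obtain ⟨G, hG⟩ := exists_boundary_hom (X := e) fun x => c.along q 0 (s x)
  -- Every point `x` is joined to `q 0` by the path over the segment from 0 to `s x`, and `G`
  -- subtracts these. Each path class then becomes an integral multiple of the fundamental loop, so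
  -- `S` is everything; on cycles the correction `G` vanishes.
  let S : AddSubgroup ((singularChains e).opcycles 1) :=
    (AddSubgroup.zmultiples (c.along q 0 1)).comap (AddMonoidHom.id _ - G.comp (classBoundary e))
  have hS : z ∈ S := by
    refine mem_of_pathClass_mem S (fun γ => ?_) z
    have hmem : ∀ r : ℝ, c.along q 0 r - c.along q 0 (s (q r)) ∈
        AddSubgroup.zmultiples (c.along q 0 1) := by
      intro r
      obtain ⟨n, hn⟩ := (hq.eq_iff r (s (q r))).1 (hs (q r)).symm
      refine ⟨n, ?_⟩
      have h1 := c.along_shift q hq.add_int 0 (s (q r)) n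
      rw [zero_add, ← hn] at h1
      rw [← h1, ← c.along_add q 0 n r, add_sub_cancel_right]
      exact (c.along_int q hq.add_int n).symm
    obtain ⟨l, hl, -⟩ := hq.isCoveringMap.exists_path_lifts γ (s (γ 0)) (hs _).symm
    have hl' : ∀ t, q (l t) = γ t := fun t => congrFun hl t
    have h1 : pathClass γ = c.along q (l 0) (l 1) :=
      c.path_eq_along_of_lift q γ l (ContinuousMap.ext hl')
    change pathClass γ - G (classBoundary e (pathClass γ)) ∈ AddSubgroup.zmultiples (c.along q 0 1)
    rw [classBoundary_pathClass, map_sub, hG, hG, h1, ← hl', ← hl']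
    have h2 : c.along q (l 0) (l 1) = c.along q 0 (l 1) - c.along q 0 (l 0) := by
      rw [← c.along_add q 0 (l 0) (l 1), add_sub_cancel_left]
    rw [h2]
    have := sub_mem (hmem (l 1)) (hmem (l 0))
    convert this using 1
    abel
  have : z - G (classBoundary e z) ∈ AddSubgroup.zmultiples (c.along q 0 1) := hS
  rwa [hz, map_zero, sub_zero] at this

/-- The projection to the factor along `C`: the integer `n` with `h - n • ρ ∈ C` exists because the
factors span, and is unique because they meet trivially and `ρ` has infinite order. -/
theorem exists_hom_zmultiples {H : Type*} [AddCommGroup H] (ρ : H)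
    (hinf : Infinite (AddSubgroup.zmultiples ρ)) {C : AddSubgroup H}
    (hC : IsCompl (AddSubgroup.zmultiples ρ) C) : ∃ φ : H →+ ℤ, φ ρ = 1 := by
  have hinj : Function.Injective fun n : ℤ => n • ρ :=
    injective_zsmul_iff_not_isOfFinAddOrder.2 (infinite_zmultiples.1 (Set.infinite_coe_iff.1 hinf))
  have hex : ∀ h : H, ∃ n : ℤ, h - n • ρ ∈ C := by
    intro h
    have : h ∈ AddSubgroup.zmultiples ρ ⊔ C := by
      rw [hC.sup_eq_top]
      trivial
    obtain ⟨_, ⟨n, rfl⟩, y, hy, rfl⟩ := AddSubgroup.mem_sup.1 this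
    exact ⟨n, by simpa using hy⟩
  have huniq : ∀ (h : H) (m n : ℤ), h - m • ρ ∈ C → h - n • ρ ∈ C → m = n := by
    intro h m n hm hn
    have h1 : (m - n) • ρ ∈ C := by
      have := sub_mem hn hm
      rw [sub_sub_sub_cancel_left] at this
      rwa [sub_zsmul, ← sub_eq_add_neg]
    have h2 : (m - n) • ρ ∈ AddSubgroup.zmultiples ρ ⊓ C := ⟨⟨m - n, rfl⟩, h1⟩
    rw [hC.inf_eq_bot, AddSubgroup.mem_bot] at h2
    have := hinj (a₁ := m - n) (a₂ := 0) (by simpa using h2)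
    omega
  choose φ hφ using hex
  refine ⟨AddMonoidHom.mk' φ fun a b => ?_, ?_⟩
  · refine huniq (a + b) _ _ (hφ _) ?_
    have := add_mem (hφ a) (hφ b)
    convert this using 1
    rw [add_zsmul]
    abel
  · exact huniq ρ _ _ (hφ ρ) (by simp)

/-- An edge circle whose class generates an infinite direct factor is detected by a cocycle. -/
theorem exists_pathCocycle_of_isInfiniteDirectFactor {X : Type u} [TopologicalSpace X] (i : C(e, X))
    (hq : IsCircleCover q) (h : IsInfiniteDirectFactor (singularH1Map i)) (N : ℕ) :
    ∃ c : PathCocycle X (ZMod N), c.along (i.comp q) 0 1 = 1 := by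
  obtain ⟨hinf, C, hC⟩ := h
  set ce := pathClassCocycle e
  set cX := pathClassCocycle X
  have hloop : classBoundary e (ce.along q 0 1) = 0 := by
    refine (classBoundary_pathClass _).trans ?_
    have := hq.add_int 0 1
    simp only [Int.cast_one, zero_add] at this
    simp [affineSegmentMap, this]
  obtain ⟨ρ₀, hρ₀⟩ := exists_homologyToClasses_eq hloop
  set ρ := singularH1Map i ρ₀ with hρ
  have hιρ : homologyToClasses X ρ = cX.along (i.comp q) 0 1 := by
    rw [hρ, homologyToClasses_map, hρ₀]
    exact classMap_pathClass i _
  have hrange : (singularH1Map i).range = AddSubgroup.zmultiples ρ := by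
    refine le_antisymm ?_ ?_
    · rintro _ ⟨z, rfl⟩
      obtain ⟨n, hn⟩ := hq.mem_zmultiples (classBoundary_homologyToClasses z)
      have : z = n • ρ₀ := homologyToClasses_injective (by
        rw [map_zsmul, hρ₀]
        exact hn.symm)
      exact ⟨n, by rw [this, map_zsmul]⟩
    · rw [AddSubgroup.zmultiples_le]
      exact ⟨ρ₀, rfl⟩
  rw [hrange] at hinf hC
  obtain ⟨φ, hφ⟩ := exists_hom_zmultiples ρ hinf hC
  -- Paths from a chosen base point in each path component close up every path to a cycle, and the
  -- cocycle is `φ` of its homology class. In a triangle the closing paths cancel, so additivity is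
  -- inherited from chains.
  let base : X → X := fun x => (Quotient.mk (pathSetoid X) x).out
  have hbase : ∀ x, Joined (base x) x := fun x => Quotient.exact (s := pathSetoid X) (Quotient.out_eq _)
  have hbase' : ∀ x y, Joined x y → base x = base y := fun x y hxy => by
    have : Quotient.mk (pathSetoid X) x = Quotient.mk (pathSetoid X) y := Quotient.sound (s := pathSetoid X) hxy
    simp only [base, this]
  let g : X → (singularChains X).opcycles 1 := fun x => cX.path (hbase x).somePath
  have hg : ∀ x, classBoundary X (g x) = pointChain x - pointChain (base x) := fun x => by
    refine (classBoundary_pathClass _).trans ?_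
    simp
  have hex : ∀ γ : C(I, X), ∃ w, homologyToClasses X w = g (γ 0) + cX.val γ - g (γ 1) := by
    intro γ
    refine exists_homologyToClasses_eq ?_
    have h1 : classBoundary X (cX.val γ) = _ := classBoundary_pathClass γ
    rw [map_sub, map_add, hg, hg, h1, hbase' (γ 0) (γ 1) ⟨⟨γ, rfl, rfl⟩⟩]
    abel
  choose w hw using hex
  refine ⟨⟨fun γ => (φ (w γ) : ZMod N), fun F a b d => ?_⟩, ?_⟩
  · rw [← Int.cast_add, ← map_add]
    congr 2
    refine homologyToClasses_injective ?_
    rw [map_add, hw, hw, hw, ← cX.triangle F a b d]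
    simp only [affineSegmentMap, ContinuousMap.comp_apply, ContinuousMap.coe_mk, Set.Icc.coe_zero,
      Set.Icc.coe_one, sub_zero, one_smul, zero_smul, add_zero, sub_self, zero_add]
    abel
  -- For a loop the two closing paths coincide and cancel, which leaves `ρ` itself.
  · have : w ((i.comp q).comp (affineSegmentMap 0 1)) = ρ := by
      refine homologyToClasses_injective ?_
      rw [hw, hιρ]
      have h01 := hq.add_int 0 1
      simp only [Int.cast_one, zero_add] at h01
      simp only [affineSegmentMap, ContinuousMap.comp_apply, ContinuousMap.coe_mk, Set.Icc.coe_zero,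
        Set.Icc.coe_one, sub_zero, one_smul, zero_smul, add_zero, sub_self, zero_add, h01]
      rw [add_sub_cancel_left]
      rfl
    change ((φ (w ((i.comp q).comp (affineSegmentMap 0 1))) : ℤ) : ZMod N) = 1
    rw [this, hφ, Int.cast_one]

end

/-! ### Fibres of pullbacks, and closed lifts of circles. -/

section FiberCount

variable {E E' B B' : Type*} {p : E → B} {g : B' → B}

/-- The fibres of a pullback are the fibres of the original map. -/
def pullbackFiberEquiv (g : B' → B) (p : E → B) (b : B') :
    ((fun z : Function.Pullback g p => z.1.1) ⁻¹' {b}) ≃ (p ⁻¹' {g b}) where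
  toFun z := ⟨z.1.1.2, by
    have h : z.1.1.1 = b := z.2
    rw [Set.mem_preimage, ← z.1.2, h]
    rfl⟩
  invFun z := ⟨⟨(b, z.1), z.2.symm⟩, rfl⟩
  left_inv := by
    rintro ⟨⟨⟨b', z⟩, h⟩, rfl⟩
    rfl
  right_inv z := rfl

/-- The fibres of a fibre product are the products of the fibres. -/
def fiberProductFiberEquiv (g : B' → B) (p : E → B) (b : B) :
    ((fun z : Function.Pullback g p => g z.1.1) ⁻¹' {b}) ≃ (g ⁻¹' {b}) × (p ⁻¹' {b}) where
  toFun z := (⟨z.1.1.1, z.2⟩, ⟨z.1.1.2, by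
    have h : g z.1.1.1 = b := z.2
    rw [Set.mem_preimage, ← z.1.2, h]
    rfl⟩)
  invFun z := ⟨⟨(z.1.1, z.2.1), z.1.2.trans z.2.2.symm⟩, z.1.2⟩
  left_inv z := rfl
  right_inv z := rfl

theorem FiniteSheeted.pullback_fst (hp : FiniteSheeted p) (g : B' → B) :
    FiniteSheeted fun z : Function.Pullback g p => z.1.1 := fun b => by
  have := (hp (g b)).to_subtype
  have := Finite.of_equiv _ (pullbackFiberEquiv g p b).symm
  exact Set.toFinite _

theorem FiniteSheeted.fiberProduct (hg : FiniteSheeted g) (hp : FiniteSheeted p) :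
    FiniteSheeted fun z : Function.Pullback g p => g z.1.1 := fun b => by
  have := (hp b).to_subtype
  have := (hg b).to_subtype
  have := Finite.of_equiv _ (fiberProductFiberEquiv g p b).symm
  exact Set.toFinite _

theorem pullback_fst_surjective (hp : Function.Surjective p) (g : B' → B) :
    Function.Surjective fun z : Function.Pullback g p => z.1.1 := fun b => by
  obtain ⟨z, hz⟩ := hp (g b)
  exact ⟨⟨(b, z), hz.symm⟩, rfl⟩

end FiberCount

namespace PrincipalCover

variable {V A : Type*} [TopologicalSpace V] [AddCommGroup A] {D : TransitionData V A}

/-- The fibres of the principal covering. -/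
def fiberEquiv (v : V) : ((base : PrincipalCover D → V) ⁻¹' {v}) ≃ A where
  toFun z := z.1.coord
  invFun a := ⟨⟨v, a⟩, rfl⟩
  left_inv := by
    rintro ⟨⟨v, a⟩, rfl⟩
    rfl
  right_inv a := rfl

theorem base_surjective : Function.Surjective (base : PrincipalCover D → V) := fun v => ⟨⟨v, 0⟩, rfl⟩

theorem finiteSheeted_base [Finite A] : FiniteSheeted (base : PrincipalCover D → V) := fun v => by
  have := Finite.of_equiv _ (fiberEquiv (D := D) v).symm
  exact Set.toFinite _

end PrincipalCover

section CircleFamily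

variable {B : Type*} [TopologicalSpace B] {ι : Type*} {q : ι → C(ℝ, B)} (hq : IsCircleFamily q)
  {E : Type*} [TopologicalSpace E] {p : E → B} (hp : IsCoveringMap p)

include hq hp

/-- The monodromy lies in the symmetric group of the fibre, whose order is the factorial of the
number of sheets. -/
theorem IsCircleFamily.lift_periodic {i : ι} (hfin : (p ⁻¹' {q i 0}).Finite) {l : C(ℝ, E)}
    (hl : ∀ t, p (l t) = q i t) {n : ℤ} (hn : ((Nat.card (p ⁻¹' {q i 0})).factorial : ℤ) ∣ n) :
    l n = l 0 := by
  have := hfin.to_subtype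
  obtain ⟨m, rfl⟩ := hn
  let s : p ⁻¹' {q i 0} := ⟨l 0, hl 0⟩
  have h1 : l = fiberLift q hp i s := eq_fiberLift hp rfl hl
  have h2 : circleMonodromy hq hp i ^ (((Nat.card (p ⁻¹' {q i 0})).factorial : ℤ) * m) = 1 := by
    rw [← Nat.card_perm, zpow_mul, zpow_natCast, pow_card_eq_one', one_zpow]
  have h3 := circleMonodromy_zpow hq hp i (((Nat.card (p ⁻¹' {q i 0})).factorial : ℤ) * m) s
  rw [h2] at h3
  have h4 := congrArg Subtype.val h3
  rw [h1, fiberLift_zero]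
  exact h4.symm

theorem IsCircleFamily.isLocalHomeomorph_lift {i : ι} {l : C(ℝ, E)} (hl : ∀ t, p (l t) = q i t) :
    IsLocalHomeomorph l := by
  refine IsLocalHomeomorph.of_comp (g := p) ?_ hp.isLocalHomeomorph l.continuous
  convert hq.isLocalHomeomorph i using 1
  exact funext hl

/-- The image is closed because it is a union of components: a lift of a circle that meets the image
once lifts to `K` and so stays inside it. -/
theorem IsCircleFamily.isClosedEmbedding_of_injective {K : Type*} [TopologicalSpace K] {r : K → B}
    (hr : IsCoveringMap r) {k : C(K, E)} (hk : Function.Injective k) (hpk : ∀ x, p (k x) = r x) :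
    IsClosedEmbedding k := by
  have hloc : IsLocalHomeomorph k := by
    refine IsLocalHomeomorph.of_comp (g := p) ?_ hp.isLocalHomeomorph k.continuous
    convert hr.isLocalHomeomorph using 1
    exact funext hpk
  refine ⟨(hloc.isOpenEmbedding_of_injective hk).isEmbedding, ?_⟩
  rw [← isOpen_compl_iff, isOpen_iff_forall_mem_open]
  intro z hz
  obtain ⟨i, s, t, rfl⟩ := exists_eq_fiberLift hq hp z
  refine ⟨Set.range (fiberLift q hp i s), ?_,
    (hq.isLocalHomeomorph_lift hp (proj_fiberLift hp i s)).isOpenMap.isOpen_range, t, rfl⟩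
  rintro _ ⟨t', rfl⟩ ⟨x, hx⟩
  obtain ⟨l, hl, hlr⟩ := hr.exists_lift_real (q i) t' x (by rw [← hpk, hx, proj_fiberLift hp])
  have : k.comp l = fiberLift q hp i s := hp.lift_real_unique (t := t')
    (fun t => by rw [ContinuousMap.comp_apply, hpk, hlr, proj_fiberLift hp])
    (by rw [ContinuousMap.comp_apply, hl, hx])
  exact hz ⟨l t, by rw [← this]; rfl⟩

end CircleFamily

/-! ### Transporting cocycles across a cylinder. -/

namespace DoubleCylinder

variable {V E : Type u} [TopologicalSpace V] [TopologicalSpace E] {d : Bool → C(E, V)}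
  {A : Type*} [AddCommGroup A]

/-- The surface in the double mapping cylinder swept out by a curve in the edge space. -/
noncomputable def sweep (d : Bool → C(E, V)) (γ : C(ℝ, E)) : C(ℝ × ℝ, DoubleCylinder d) where
  toFun p := cyl d (γ p.1, Set.projIcc (-1) 1 (by norm_num) p.2)
  continuous_toFun := by
    refine continuous_cyl.comp (by fun_prop)

/-- The value of a cocycle on the segment from `+1` to `-1` over a point of the edge space. -/
noncomputable def crossing (c : PathCocycle (DoubleCylinder d) A) (x : E) : A :=
  c.val ((sweep d (.const ℝ x)).comp (affineSegmentMap (0, 1) (0, -1)))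

theorem sweep_one (γ : C(ℝ, E)) (s : ℝ) : sweep d γ (s, 1) = vert d (d true (γ s)) := by
  rw [← cyl_endpt]
  simp [sweep, GraphOfSpaces.endpt]

theorem sweep_neg_one (γ : C(ℝ, E)) (s : ℝ) : sweep d γ (s, -1) = vert d (d false (γ s)) := by
  rw [← cyl_endpt]
  simp [sweep, GraphOfSpaces.endpt]

/-- These are the two ways around the square swept out by `δ` between the levels 1 and -1. -/
theorem crossing_spec (c : PathCocycle (DoubleCylinder d) A) {x y : E} (δ : Path x y) :
    (c.comap ⟨vert d, continuous_vert⟩).path (δ.map (d true).continuous) + crossing c y =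
      crossing c x + (c.comap ⟨vert d, continuous_vert⟩).path (δ.map (d false).continuous) := by
  have h := c.square (sweep d ⟨δ.extend, δ.continuous_extend⟩) (0, 1) (1, 1) (0, -1) (1, -1)
  have h1 : (sweep d ⟨δ.extend, δ.continuous_extend⟩).comp (affineSegmentMap ((0, 1) : ℝ × ℝ) (1, 1)) =
      (⟨vert d, continuous_vert⟩ : C(V, DoubleCylinder d)).comp
        (δ.map (d true).continuous).toContinuousMap := by
    ext1 r
    have : affineSegmentMap ((0, 1) : ℝ × ℝ) (1, 1) r = ((r : ℝ), 1) := by simp [affineSegmentMap]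
    rw [ContinuousMap.comp_apply, this, sweep_one]
    simp
  have h2 : (sweep d ⟨δ.extend, δ.continuous_extend⟩).comp (affineSegmentMap ((0, -1) : ℝ × ℝ) (1, -1)) =
      (⟨vert d, continuous_vert⟩ : C(V, DoubleCylinder d)).comp
        (δ.map (d false).continuous).toContinuousMap := by
    ext1 r
    have : affineSegmentMap ((0, -1) : ℝ × ℝ) (1, -1) r = ((r : ℝ), -1) := by
      simp only [affineSegmentMap, ContinuousMap.coe_mk, Prod.smul_mk, Prod.mk_add_mk, smul_eq_mul]
      ring_nf
    rw [ContinuousMap.comp_apply, this, sweep_neg_one]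
    simp
  have h3 : (sweep d ⟨δ.extend, δ.continuous_extend⟩).comp (affineSegmentMap ((1, 1) : ℝ × ℝ) (1, -1)) =
      (sweep d (.const ℝ y)).comp (affineSegmentMap (0, 1) (0, -1)) := by
    ext1 r
    simp [sweep, affineSegmentMap]
  have h4 : (sweep d ⟨δ.extend, δ.continuous_extend⟩).comp (affineSegmentMap ((0, 1) : ℝ × ℝ) (0, -1)) =
      (sweep d (.const ℝ x)).comp (affineSegmentMap (0, 1) (0, -1)) := by
    ext1 r
    simp [sweep, affineSegmentMap]
  rw [h1, h2, h3, h4] at h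
  exact h

/-- A closed curve in the edge space has the same value at all levels of the cylinder. -/
theorem along_vert_eq (c : PathCocycle (DoubleCylinder d) A) (γ : C(ℝ, E)) (hγ : γ 1 = γ 0)
    (s : Bool) : (c.comap ⟨vert d, continuous_vert⟩).along ((d s).comp γ) 0 1 =
      c.val ((sweep d γ).comp (affineSegmentMap (0, 0) (1, 0))) := by
  -- The square between the levels 0 and `a` has equal vertical sides, because `γ` closes up, and
  -- they cancel.
  have key : ∀ a : ℝ, c.val ((sweep d γ).comp (affineSegmentMap (0, a) (1, a))) =
      c.val ((sweep d γ).comp (affineSegmentMap (0, 0) (1, 0))) := by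
    intro a
    have h := c.square (sweep d γ) (0, 0) (1, 0) (0, a) (1, a)
    have h1 : (sweep d γ).comp (affineSegmentMap ((1, 0) : ℝ × ℝ) (1, a)) =
        (sweep d γ).comp (affineSegmentMap (0, 0) (0, a)) := by
      ext1 r
      simp [sweep, affineSegmentMap, hγ]
    rw [h1, add_comm] at h
    exact (add_left_cancel h).symm
  cases s
  · rw [← key (-1)]
    refine congrArg c.val (ContinuousMap.ext fun r => ?_)
    have : affineSegmentMap ((0, -1) : ℝ × ℝ) (1, -1) r = ((r : ℝ), -1) := by
      simp only [affineSegmentMap, ContinuousMap.coe_mk, Prod.smul_mk, Prod.mk_add_mk, smul_eq_mul]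
      ring_nf
    refine Eq.symm (((congrArg (sweep d γ) this).trans (sweep_neg_one γ r)).trans ?_)
    simp [affineSegmentMap]
  · rw [← key 1]
    refine congrArg c.val (ContinuousMap.ext fun r => ?_)
    have : affineSegmentMap ((0, 1) : ℝ × ℝ) (1, 1) r = ((r : ℝ), 1) := by
      simp [affineSegmentMap]
    refine Eq.symm (((congrArg (sweep d γ) this).trans (sweep_one γ r)).trans ?_)
    simp [affineSegmentMap]

end DoubleCylinder

/-! ### The gluing construction. -/

/-- A pre-covering of double mapping cylinders over a union of circles embeds, after passing to
finite coverings, in a finite covering. -/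
theorem DoubleCylinder.exists_finite_covering_extending {V E V' E' W A : Type u} {ι : Type*}
    [TopologicalSpace V] [TopologicalSpace E] [TopologicalSpace V'] [TopologicalSpace E']
    [TopologicalSpace W] [AddCommGroup A] [Finite A] [LocallyPathConnectedSpace V]
    [LocallyPathConnectedSpace E]
    {d : Bool → C(E, V)} {d' : Bool → C(E', V')} (fV : C(V', V)) (fE : C(E', E))
    (comm : ∀ s z, fV (d' s z) = d s (fE z)) (hfE : IsCoveringMap fE)
    (hinj : ∀ s y y', fE y = fE y' → d' s y = d' s y' → y = y')
    {q : ι → C(ℝ, E)} (hq : IsCircleFamily q) {g : C(W, V)} (hg : IsCoveringMap g)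
    {n : ℕ} (hn : 0 < n) (hgcard : ∀ v, Nat.card (g ⁻¹' {v}) = n) {j : C(V', W)}
    (hj : IsClosedEmbedding j) (hgj : ∀ z, g (j z) = fV z)
    (c : PathCocycle (DoubleCylinder d) A)
    (hc : (c.comap ⟨vert d, continuous_vert⟩).LocallyTrivial)
    (horder : ∀ i s (k : ℤ), k • (c.comap ⟨vert d, continuous_vert⟩).along ((d s).comp (q i)) 0 1 = 0 ↔
      (n.factorial : ℤ) ∣ k) :
    ∃ (Xhat Xtilde : Type u) (_ : TopologicalSpace Xhat) (_ : TopologicalSpace Xtilde)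
      (p : Xhat → DoubleCylinder d') (r : Xtilde → DoubleCylinder d) (J : Xhat → Xtilde),
      IsFiniteSheetedCovering p ∧ IsFiniteSheetedCovering r ∧ IsEmbedding J ∧
        r ∘ J = map fV fE comm ∘ p := by
  set cV := c.comap ⟨vert d, continuous_vert⟩ with hcV
  obtain ⟨D, hD⟩ := cV.exists_isAdapted hc
  let π : PrincipalCover D → V := PrincipalCover.base
  have hπ : IsCoveringMap π := PrincipalCover.isCoveringMap
  have hπc : Continuous π := hπ.continuous
  have hπs : Function.Surjective π := PrincipalCover.base_surjective
  have hπf : FiniteSheeted π := PrincipalCover.finiteSheeted_base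
  have hgfin : FiniteSheeted g := fun v => by
    have : Finite (g ⁻¹' {v}) := Nat.finite_of_card_ne_zero (by rw [hgcard]; omega)
    exact Set.toFinite _
  have hgs : Function.Surjective g := fun v => by
    have : Nonempty (g ⁻¹' {v}) := by
      by_contra h
      rw [not_nonempty_iff] at h
      have := hgcard v
      rw [Nat.card_of_isEmpty] at this
      omega
    exact ⟨this.some.1, this.some.2⟩
  have : NeZero n.factorial := ⟨n.factorial_ne_zero⟩
  -- the vertex space of the big covering
  let pZ : C(Function.Pullback g π, V) := ⟨fun z => g z.1.1, by fun_prop⟩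
  have hpZ : IsCoveringMap pZ := hg.fiberProduct hπ
  have hpZf : FiniteSheeted pZ := hgfin.fiberProduct hπf
  -- its pullbacks to the edge space
  let pE : ∀ s, C(Function.Pullback (d s) pZ, E) := fun s => ⟨fun z => z.1.1, by fun_prop⟩
  have hpE : ∀ s, IsCoveringMap (pE s) := fun s => hpZ.pullback_fst (d s).continuous
  have hpEf : ∀ s, FiniteSheeted (pE s) := fun s => hpZf.pullback_fst (d s)
  have hcardE : ∀ s b, Nat.card (pE s ⁻¹' {b}) = n * Nat.card A := by
    intro s b
    refine (Nat.card_congr (pullbackFiberEquiv (d s) pZ b)).trans ?_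
    refine (Nat.card_congr (fiberProductFiberEquiv g π (d s b))).trans ?_
    rw [Nat.card_prod, hgcard]
    exact congrArg _ (Nat.card_congr (PrincipalCover.fiberEquiv _))
  -- the edge space of the small covering
  let pPE : C(Function.Pullback (d true) π, E) := ⟨fun z => z.1.1, by fun_prop⟩
  have hpPE : IsCoveringMap pPE := hπ.pullback_fst (d true).continuous
  let r : C(Function.Pullback fE pPE, E) := ⟨fun z => fE z.1.1, by fun_prop⟩
  have hr : IsCoveringMap r := hfE.fiberProduct hpPE
  -- Translation by `crossing` carries the pullback of the principal covering at the + end to the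
  -- one at the - end.
  let κ : C(Function.Pullback (d true) π, PrincipalCover D) := ⟨fun z => ⟨d false z.1.1, z.1.2.coord + crossing c z.1.1⟩,
    hD.continuous_shift (d true) (d false) (crossing c) (crossing_spec c)⟩
  -- the small covering maps to the two pullbacks
  let Kp : Bool → C(Function.Pullback fE pPE, PrincipalCover D) := fun s => match s with
    | true => ⟨fun z => z.1.2.1.2, by fun_prop⟩
    | false => ⟨fun z => κ z.1.2, by fun_prop⟩
  have hKp : ∀ s z, π (Kp s z) = d s (fE z.1.1) := by
    rintro (_ | _) z
    · rw [show fE z.1.1 = pPE z.1.2 from z.2]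
      rfl
    · rw [show fE z.1.1 = pPE z.1.2 from z.2]
      exact z.1.2.2.symm
  let k : ∀ s, C(Function.Pullback fE pPE, Function.Pullback (d s) pZ) := fun s =>
    ⟨fun z => ⟨(fE z.1.1, ⟨(j (d' s z.1.1), Kp s z), (hgj _).trans ((comm _ _).trans (hKp _ _).symm)⟩),
      (comm _ _).symm.trans (hgj _).symm⟩, by fun_prop⟩
  have hkinj : ∀ s, Function.Injective (k s) := by
    intro s z z' h
    have h1 : fE z.1.1 = fE z'.1.1 := congrArg (fun w => w.1.1) h
    have h2 : d' s z.1.1 = d' s z'.1.1 := hj.injective (congrArg (fun w => w.1.2.1.1) h)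
    have h3 : Kp s z = Kp s z' := congrArg (fun w => w.1.2.1.2) h
    have h4 := hinj s _ _ h1 h2
    have h5 : z.1.2.1.1 = z'.1.2.1.1 := by
      have e1 : fE z.1.1 = z.1.2.1.1 := z.2
      have e2 : fE z'.1.1 = z'.1.2.1.1 := z'.2
      rw [← e1, ← e2, h1]
    have h6 : z.1.2.1.2 = z'.1.2.1.2 := by
      cases s
      · refine PrincipalCover.ext ?_ ?_
        · have e1 : d true z.1.2.1.1 = z.1.2.1.2.base := z.1.2.2
          have e2 : d true z'.1.2.1.1 = z'.1.2.1.2.base := z'.1.2.2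
          rw [← e1, ← e2, h5]
        · have e1 : z.1.2.1.2.coord + crossing c z.1.2.1.1 =
            z'.1.2.1.2.coord + crossing c z'.1.2.1.1 := congrArg PrincipalCover.coord h3
          rw [h5] at e1
          exact add_right_cancel e1
      · exact h3
    exact Subtype.ext (Prod.ext h4 (Subtype.ext (Prod.ext h5 h6)))
  -- the monodromy is free
  have hfree : ∀ s i (l : C(ℝ, Function.Pullback (d s) pZ)), (∀ t, pE s (l t) = q i t) →
      ∀ m : ℤ, l m = l 0 ↔ (n.factorial : ℤ) ∣ m := by
    intro s i l hl m
    have hper : ∀ (t : ℝ) (m : ℤ), ((d s).comp (q i)) (t + m) = ((d s).comp (q i)) t := fun t m => by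
      rw [ContinuousMap.comp_apply, hq.add_int, ContinuousMap.comp_apply]
    let lP : C(ℝ, PrincipalCover D) := ⟨fun t => (l t).1.2.1.2, by fun_prop⟩
    have hlP : ∀ t, (lP t).base = ((d s).comp (q i)) t := fun t => by
      have e1 : g (l t).1.2.1.1 = π (lP t) := (l t).1.2.2
      have e2 : d s (l t).1.1 = g (l t).1.2.1.1 := (l t).2
      rw [ContinuousMap.comp_apply, ← hl]
      exact e1.symm.trans e2.symm
    have hcoord := hD.coord_sub lP _ hlP 0 m
    rw [cV.along_int _ hper] at hcoord
    rw [← horder i s m, ← hcoord, sub_eq_zero]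
    constructor
    · intro h
      exact congrArg (fun w => w.1.2.1.2.coord) h
    · intro h
      have hm : (n.factorial : ℤ) ∣ m := by
        rw [← horder i s m, ← hcoord, h, sub_self]
      have hbase : (l m).1.1 = (l 0).1.1 := by
        have e1 := hl m
        have e2 := hl 0
        have e3 := hq.add_int i 0 m
        rw [zero_add] at e3
        exact e1.trans (e3.trans e2.symm)
      -- The principal coordinate alone forces `n!` to divide `m`; since `g` has `n` sheets, the
      -- point of `W` then returns as well.
      have hW : (l m).1.2.1.1 = (l 0).1.2.1.1 := by
        let lW : C(ℝ, Function.Pullback (d s) g) := ⟨fun t => ⟨((l t).1.1, (l t).1.2.1.1), (l t).2⟩,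
          by fun_prop⟩
        have hcard : Nat.card ((fun z : Function.Pullback (d s) g => z.1.1) ⁻¹' {q i 0}) = n := by
          rw [Nat.card_congr (pullbackFiberEquiv (d s) g (q i 0)), hgcard]
        have := hq.lift_periodic (hg.pullback_fst (d s).continuous)
          (hgfin.pullback_fst (d s) (q i 0)) (l := lW) hl (n := m) (by rw [hcard]; exact hm)
        exact congrArg (fun w => w.1.2) this
      have hP : lP m = lP 0 := PrincipalCover.ext (by
        rw [hlP, hlP]
        have e3 := hper 0 m
        rwa [zero_add] at e3) h
      exact Subtype.ext (Prod.ext hbase (Subtype.ext (Prod.ext hW hP)))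
  -- Both pullbacks have degree `n * Nat.card A` and all their cycles have length `n!`, so they can
  -- be identified compatibly with `k`. The pullback at the + end will serve as edge space of the
  -- big covering, attached at its - end through `Θ`.
  obtain ⟨Θ, hΘ, hΘk⟩ := exists_homeomorph_extending hq (hpE true) (hpE false) hr (hpEf true)
    (hpEf false) (fun b => by rw [hcardE, hcardE]) (hfree true) (hfree false) (k true) (k false)
    (hkinj true) (hkinj false) (fun x => rfl) (fun x => rfl)
  -- the big covering
  let dZ : Bool → C(Function.Pullback (d true) pZ, Function.Pullback g π) := fun s => match s with
    | true => ⟨fun z => z.1.2, by fun_prop⟩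
    | false => ⟨fun z => (Θ z).1.2, by
      have := Θ.continuous
      fun_prop⟩
  have commZ : ∀ s z, pZ (dZ s z) = d s (pE true z) := by
    rintro (_ | _) z
    · rw [← hΘ]
      exact (Θ z).2.symm
    · exact z.2.symm
  -- the small covering
  let pVh : C(Function.Pullback fV π, V') := ⟨fun z => z.1.1, by fun_prop⟩
  have hpVh : IsCoveringMap pVh := hπ.pullback_fst fV.continuous
  let pK : C(Function.Pullback fE pPE, E') := ⟨fun z => z.1.1, by fun_prop⟩
  have hpK : IsCoveringMap pK := hpPE.pullback_fst fE.continuous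
  let dK : Bool → C(Function.Pullback fE pPE, Function.Pullback fV π) := fun s =>
    ⟨fun z => ⟨(d' s z.1.1, Kp s z), (comm _ _).trans (hKp _ _).symm⟩, by fun_prop⟩
  have commK : ∀ s z, pVh (dK s z) = d' s (pK z) := fun s z => rfl
  -- the embedding
  let jV : C(Function.Pullback fV π, Function.Pullback g π) := ⟨fun z => ⟨(j z.1.1, z.1.2), (hgj _).trans z.2⟩, by fun_prop⟩
  have commJ : ∀ s z, jV (dK s z) = dZ s (k true z) := by
    rintro (_ | _) z
    · change _ = (Θ (k true z)).1.2
      rw [hΘk]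
      rfl
    · rfl
  have hjV : IsClosedEmbedding jV := by
    have h1 : IsEmbedding (Prod.map j id : V' × PrincipalCover D → W × PrincipalCover D) :=
      hj.isEmbedding.prodMap .id
    have h2 : IsEmbedding (Subtype.val ∘ jV) := h1.comp (IsEmbedding.subtypeVal)
    refine ⟨.of_comp jV.continuous continuous_subtype_val h2, ?_⟩
    have : Set.range jV = (fun z : Function.Pullback g π => z.1.1) ⁻¹' Set.range j := by
      ext z
      constructor
      · rintro ⟨x, rfl⟩
        exact ⟨x.1.1, rfl⟩
      · rintro ⟨x, hx⟩
        exact ⟨⟨(x, z.1.2), by rw [← hgj, hx]; exact z.2⟩, Subtype.ext (Prod.ext hx rfl)⟩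
    rw [this]
    exact hj.isClosed_range.preimage (by fun_prop)
  have hjK : IsClosedEmbedding (k true) :=
    hq.isClosedEmbedding_of_injective (hpE true) hr (hkinj true) fun x => rfl
  refine ⟨DoubleCylinder dK, DoubleCylinder dZ, inferInstance, inferInstance,
    map pVh pK commK, map pZ (pE true) commZ, map jV (k true) commJ,
    ⟨isCoveringMap_map _ _ _ hpVh hpK ?_ ?_, surjective_map _ _ _ ?_ ?_, finiteSheeted_map _ _ _ ?_ ?_⟩,
    ⟨isCoveringMap_map _ _ _ hpZ (hpE true) ?_ ?_, surjective_map _ _ _ ?_ ?_,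
      finiteSheeted_map _ _ _ hpZf (hpEf true)⟩,
    (isClosedEmbedding_map _ _ _ hjV hjK).isEmbedding, ?_⟩
  · rintro s y ⟨⟨v, w⟩, hvw⟩ h
    obtain rfl : d' s y = v := h
    have hw : d s (fE y) = w.base := by
      rw [← comm]
      exact hvw
    cases s
    -- Subtracting `crossing` undoes the translation `κ`.
    · refine ⟨⟨(y, ⟨(fE y, ⟨d true (fE y), w.coord - crossing c (fE y)⟩), rfl⟩), rfl⟩, rfl,
        Subtype.ext (Prod.ext rfl (PrincipalCover.ext hw ?_))⟩
      exact sub_add_cancel _ _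
    · exact ⟨⟨(y, ⟨(fE y, w), hw⟩), rfl⟩, rfl, rfl⟩
  · intro s z z' h h'
    refine hkinj s (Subtype.ext (Prod.ext (congrArg fE h) (Subtype.ext (Prod.ext ?_ ?_))))
    · exact congrArg (fun w => j w.1.1) h'
    · exact congrArg (fun w => w.1.2) h'
  · exact pullback_fst_surjective hπs fV
  · exact pullback_fst_surjective (pullback_fst_surjective hπs _) fE
  · exact hπf.pullback_fst fV
  · exact (hπf.pullback_fst (d true)).pullback_fst fE
  · intro s x z h
    cases s
    · refine ⟨Θ.symm ⟨(x, z), h⟩, ?_, ?_⟩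
      · rw [← hΘ, Θ.apply_symm_apply]
        rfl
      · change (Θ (Θ.symm ⟨(x, z), h⟩)).1.2 = z
        rw [Θ.apply_symm_apply]
    · exact ⟨⟨(x, z), h⟩, rfl, rfl⟩
  · intro s y y' h h'
    cases s
    · refine Θ.injective (Subtype.ext (Prod.ext ?_ h'))
      exact (hΘ y).trans (h.trans (hΘ y').symm)
    · exact Subtype.ext (Prod.ext h h')
  · intro v
    obtain ⟨w, hw⟩ := hgs v
    obtain ⟨x, hx⟩ := hπs v
    exact ⟨⟨(w, x), hw.trans hx.symm⟩, hw⟩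
  · refine pullback_fst_surjective ?_ _
    intro v
    obtain ⟨w, hw⟩ := hgs v
    obtain ⟨x, hx⟩ := hπs v
    exact ⟨⟨(w, x), hw.trans hx.symm⟩, hw⟩
  · funext z
    induction z using Quot.ind with | mk z => ?_
    rcases z with z | ⟨z, t⟩
    · change vert d (g (j z.1.1)) = vert d (fV z.1.1)
      rw [hgj]
    · rfl

/-! ### Completing a finite covering to constant degree. -/

section Sum

variable {E E' B : Type*} [TopologicalSpace E] [TopologicalSpace E'] [TopologicalSpace B]

theorem IsSheets.sumElim {p : E → B} {p' : E' → B} {U : Set B} {S S' : Type*} {O : S → Set E}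
    {O' : S' → Set E'} (h : IsSheets p U O) (h' : IsSheets p' U O') :
    IsSheets (Sum.elim p p') U
      (Sum.elim (fun s => Sum.inl '' O s) fun s => Sum.inr '' O' s : S ⊕ S' → Set (E ⊕ E')) where
  isOpen_base := h.isOpen_base
  isOpen := by
    rintro (s | s)
    · exact isOpenMap_inl _ (h.isOpen s)
    · exact isOpenMap_inr _ (h'.isOpen s)
  mem_base := by
    rintro (s | s) _ ⟨z, hz, rfl⟩
    · exact h.mem_base s z hz
    · exact h'.mem_base s z hz
  exists_lift := by
    rintro (s | s) b hb
    · obtain ⟨z, hz, rfl⟩ := h.exists_lift s b hb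
      exact ⟨_, ⟨z, hz, rfl⟩, rfl⟩
    · obtain ⟨z, hz, rfl⟩ := h'.exists_lift s b hb
      exact ⟨_, ⟨z, hz, rfl⟩, rfl⟩
  inj := by
    rintro (s | s) _ ⟨z, hz, rfl⟩ _ ⟨z', hz', rfl⟩ hzz
    · exact congrArg _ (h.inj s z hz z' hz' hzz)
    · exact congrArg _ (h'.inj s z hz z' hz' hzz)
  cover := by
    rintro (z | z) hz
    · obtain ⟨s, hs⟩ := h.cover z hz
      exact ⟨Sum.inl s, z, hs, rfl⟩
    · obtain ⟨s, hs⟩ := h'.cover z hz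
      exact ⟨Sum.inr s, z, hs, rfl⟩
  disj := by
    rintro _ (s | s) (t | t) ⟨z, hz, rfl⟩ ⟨z', hz', h1⟩
    · obtain rfl := Sum.inl_injective h1
      rw [h.disj _ s t hz hz']
    · simp at h1
    · simp at h1
    · obtain rfl := Sum.inr_injective h1
      rw [h'.disj _ s t hz hz']

theorem IsCoveringMap.sumElim {p : E → B} {p' : E' → B} (hp : IsCoveringMap p)
    (hp' : IsCoveringMap p') : IsCoveringMap (Sum.elim p p') := by
  refine isCoveringMap_of_isSheets (hp.continuous.sumElim hp'.continuous)
    (hp.isOpenMap.sumElim hp'.isOpenMap) fun b => ?_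
  obtain ⟨U, O, hb, hO⟩ := hp.exists_isSheets b
  obtain ⟨U', O', hb', hO'⟩ := hp'.exists_isSheets b
  have hU := hO.isOpen_base.inter hO'.isOpen_base
  exact ⟨U ∩ U', _, _, ⟨hb, hb'⟩, (hO.mono hp.continuous hU Set.inter_subset_left).sumElim
    (hO'.mono hp'.continuous hU Set.inter_subset_right)⟩

theorem isCoveringMap_id : IsCoveringMap (id : B → B) :=
  isCoveringMap_of_isSheets continuous_id IsOpenMap.id fun _ => ⟨Set.univ, Unit, fun _ => Set.univ,
    trivial, isOpen_univ, fun _ => isOpen_univ, fun _ _ _ => trivial, fun _ b _ => ⟨b, trivial, rfl⟩,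
    fun _ _ _ _ _ h => h, fun _ _ => ⟨(), trivial⟩, fun _ _ _ _ _ => rfl⟩

end Sum

/-- A finite covering of a space with finitely many components is part of a covering of constant
positive degree. -/
theorem IsCoveringMap.exists_const_degree {ι : Type u} [Finite ι] {C : ι → Type u}
    [∀ v, TopologicalSpace (C v)] [∀ v, ConnectedSpace (C v)] {F : Type u} [TopologicalSpace F]
    {f : C(F, Σ v, C v)} (hf : IsCoveringMap f) (hfin : FiniteSheeted f) :
    ∃ (n : ℕ) (W : Type u) (_ : TopologicalSpace W) (g : C(W, Σ v, C v)) (j : C(F, W)), 0 < n ∧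
      IsCoveringMap g ∧ (∀ b, Nat.card (g ⁻¹' {b}) = n) ∧ IsClosedEmbedding j ∧
      ∀ z, g (j z) = f z := by
  have _ := Fintype.ofFinite ι
  obtain ⟨m, hm⟩ : ∃ m : ι → ℕ, ∀ b, Nat.card (f ⁻¹' {b}) = m b.1 := by
    refine ⟨fun v => Nat.card (f ⁻¹' {⟨v, Classical.arbitrary (C v)⟩}), fun ⟨v, x⟩ => ?_⟩
    exact (hf.isLocallyConstant_card_fiber.comp_continuous
      (continuous_sigmaMk (i := v))).apply_eq_of_isPreconnected isPreconnected_univ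
      (Set.mem_univ x) (Set.mem_univ _)
  -- Any positive bound for all the degrees would do; the summand 1 keeps `n` positive when `F` is
  -- empty. Over `C v` the missing `n - m v` sheets are copies of `C v`.
  let n := 1 + ∑ v, m v
  have hmn : ∀ v, m v ≤ n := fun v =>
    (Finset.single_le_sum (fun _ _ => Nat.zero_le _) (Finset.mem_univ v)).trans (Nat.le_add_left _ 1)
  let o : (Σ v : ι, Fin (n - m v)) → ι := Sigma.fst
  let T : (Σ i : (Σ v : ι, Fin (n - m v)), C i.1) → Σ v, C v := Sigma.map o fun _ => id
  have hT : ∀ b, Nonempty (Fin (n - m b.1) ≃ T ⁻¹' {b}) := by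
    rintro ⟨v, x⟩
    refine ⟨Equiv.ofBijective (fun k => ⟨⟨⟨v, k⟩, x⟩, rfl⟩) ⟨fun k l h => ?_, ?_⟩⟩
    · have h' : (⟨v, k⟩ : Σ v, Fin (n - m v)) = ⟨v, l⟩ := congrArg (fun z => z.1.1) h
      exact eq_of_heq (Sigma.mk.inj h').2
    · rintro ⟨⟨⟨w, k⟩, y⟩, h⟩
      obtain rfl : w = v := congrArg Sigma.fst h
      obtain rfl : y = x := eq_of_heq (Sigma.mk.inj h).2
      exact ⟨k, rfl⟩
  have hTfin : ∀ b, (T ⁻¹' {b}).Finite := fun b => by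
    have := Finite.of_equiv _ (hT b).some
    exact Set.toFinite _
  have hTc : IsCoveringMap T :=
    isCoveringMap_sigmaMap o (fun _ => id) (fun _ => isCoveringMap_id) hTfin
  refine ⟨n, F ⊕ Σ i : (Σ v : ι, Fin (n - m v)), C i.1, inferInstance,
    ⟨Sum.elim f T, f.continuous.sumElim hTc.continuous⟩, ⟨Sum.inl, continuous_inl⟩, by omega,
    hf.sumElim hTc, fun b => ?_, .inl, fun z => rfl⟩
  have e : (Sum.elim f T ⁻¹' {b}) ≃ (f ⁻¹' {b}) ⊕ (T ⁻¹' {b}) := Equiv.subtypeSum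
  have := (hfin b).to_subtype
  have := (hTfin b).to_subtype
  refine (Nat.card_congr e).trans ?_
  rw [Nat.card_sum, hm, ← Nat.card_congr (hT b).some, Nat.card_eq_fintype_card, Fintype.card_fin]
  have := hmn b.1
  omega

theorem PathCocycle.locallyTrivial_sigma {ι : Type*} {C : ι → Type*} [∀ v, TopologicalSpace (C v)]
    {A : Type*} [AddCommGroup A] (c : PathCocycle (Σ v, C v) A)
    (h : ∀ v, (c.comap ⟨Sigma.mk v, continuous_sigmaMk⟩).LocallyTrivial) : c.LocallyTrivial := by
  rintro ⟨v, x⟩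
  obtain ⟨U, hU, hγ⟩ := h v x
  refine ⟨Sigma.mk v '' U, isOpenMap_sigmaMk.image_mem_nhds hU, fun γ hr => ?_⟩
  choose δ hδU hδ using fun t => hr ⟨t, rfl⟩
  have hinj : Function.Injective (Sigma.mk v : C v → Σ v, C v) := sigma_mk_injective
  let γ' : Path x x :=
    { toFun := δ
      continuous_toFun := by
        rw [IsEmbedding.sigmaMk.continuous_iff (f := δ) (g := (Sigma.mk v : C v → Σ v, C v))]
        exact γ.continuous.congr fun t => (hδ t).symm
      source' := hinj ((hδ 0).trans γ.source)
      target' := hinj ((hδ 1).trans γ.target) }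
  rw [← hγ γ' (by rintro _ ⟨t, rfl⟩; exact hδU t)]
  exact congrArg c.val (ContinuousMap.ext fun t => (hδ t).symm)

/-! ### What a pre-covering says about its vertex and edge maps. -/

namespace DoubleCylinder

open GraphOfSpaces

variable {V E V' E' : Type u} [TopologicalSpace V] [TopologicalSpace E] [TopologicalSpace V']
  [TopologicalSpace E'] {d : Bool → C(E, V)} {d' : Bool → C(E', V')}
  {gV : C(V', V)} {gE : C(E', E)} {comm : ∀ s z, gV (d' s z) = d s (gE z)}

theorem dense_ne_endpt : Dense {t : SignedInterval | ∀ s, t ≠ endpt s} := by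
  have : ConnectedSpace SignedInterval := Subtype.connectedSpace (isConnected_Icc (by norm_num))
  have : Nontrivial SignedInterval := ⟨endpt true, endpt false, by simp [endpt_injective.eq_iff]⟩
  have h := Dense.sdiff_finite (s := (Set.univ : Set SignedInterval)) dense_univ
    (Set.finite_range endpt)
  convert h using 1
  ext t
  simp

/-- If a map of double mapping cylinders is locally injective, edge points with the same image and
the same endpoint agree. -/
theorem eq_of_isLocallyInjective (h : IsLocallyInjective (map gV gE comm)) (s : Bool) (y y' : E')
    (hg : gE y = gE y') (hd : d' s y = d' s y') : y = y' := by
  obtain ⟨U, hU, hyU, hinj⟩ := h (vert d' (d' s y))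
  -- Close to the common end, the segments over `y` and `y'` both lie in `U`. Comparing them at an
  -- interior level separates edge points that the gluing at the end would identify.
  have hopen : ∀ z : E', IsOpen {t : SignedInterval | cyl d' (z, t) ∈ U} := fun z =>
    hU.preimage (continuous_cyl.comp (by fun_prop))
  obtain ⟨t, ⟨ht, ht'⟩, hts⟩ := dense_ne_endpt.inter_open_nonempty _ ((hopen y).inter (hopen y'))
    ⟨endpt s, by rwa [Set.mem_ofPred_eq, cyl_endpt], by rwa [Set.mem_ofPred_eq, cyl_endpt, ← hd]⟩
  have := hinj ht ht' (by rw [map_cyl, map_cyl, hg])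
  exact congrArg Prod.fst (cyl_inj (by exact hts) (by exact hts) this)

theorem finiteSheeted_of_map_vert (h : FiniteSheeted (map gV gE comm)) : FiniteSheeted gV := by
  intro v
  refine ((h (vert d v)).preimage vert_injective.injOn).subset fun z hz => ?_
  rw [Set.mem_preimage, Set.mem_preimage, map_vert, show gV z = v from hz]
  rfl

theorem finiteSheeted_of_map_cyl (h : FiniteSheeted (map gV gE comm)) : FiniteSheeted gE := by
  intro x
  have : Nonempty SignedInterval := ⟨endpt true⟩
  obtain ⟨t, ht⟩ := dense_ne_endpt.nonempty
  refine ((h (cyl d (x, t))).preimage (f := fun z => cyl d' (z, t)) fun z _ z' _ hz => ?_).subset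
    fun z hz => ?_
  · exact congrArg Prod.fst (cyl_inj (by exact ht) (by exact ht) hz)
  · rw [Set.mem_preimage, Set.mem_preimage, map_cyl, show gE z = x from hz]
    rfl

end DoubleCylinder

/-! ### Assembly for graphs of spaces. -/

theorem IsCircleCover.sigma {ι : Type*} {C : ι → Type*} [∀ e, TopologicalSpace (C e)]
    {q : ∀ e, C(ℝ, C e)} (hq : ∀ e, IsCircleCover (q e)) :
    IsCircleFamily fun e => (⟨fun t => ⟨e, q e t⟩, by fun_prop⟩ : C(ℝ, Σ e, C e)) where
  isLocalHomeomorph e :=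
    IsOpenEmbedding.sigmaMk.isLocalHomeomorph.comp (hq e).isCoveringMap.isLocalHomeomorph
  surjective := by
    rintro ⟨e, x⟩
    obtain ⟨t, rfl⟩ := (hq e).surjective x
    exact ⟨e, t, rfl⟩
  eq_iff e e' s t := by
    constructor
    · intro h
      obtain rfl : e = e' := congrArg Sigma.fst h
      exact ⟨rfl, ((hq e).eq_iff s t).1 (eq_of_heq (Sigma.mk.inj h).2)⟩
    · rintro ⟨rfl, h⟩
      exact congrArg (Sigma.mk e) (((hq e).eq_iff s t).2 h)

/-- The edge circle in a vertex space is slid along the cylinder to level 0, where `edgeIncl` places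
it and the homological hypothesis applies. -/
theorem GraphOfSpaces.along_vert_realizationHomeo (X : GraphOfSpaces.{u}) {A : Type*}
    [AddCommGroup A] (c : PathCocycle X.Realization A) (e : X.E) {q : C(ℝ, X.edge e)}
    (hq : q 1 = q 0) (s : Bool) :
    ((c.comap ⟨_, X.realizationHomeo.symm.continuous⟩).comap
      ⟨DoubleCylinder.vert X.totalBd, DoubleCylinder.continuous_vert⟩).along
        ((X.totalBd s).comp ⟨fun t => ⟨e, q t⟩, by fun_prop⟩) 0 1 =
      c.along ((X.edgeIncl e).comp q) 0 1 := by
  rw [DoubleCylinder.along_vert_eq _ _ (congrArg (Sigma.mk e) hq)]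
  refine congrArg c.val (ContinuousMap.ext fun r => ?_)
  have h1 : affineSegmentMap ((0, 0) : ℝ × ℝ) (1, 0) r = (affineSegmentMap 0 1 r, 0) := by
    simp [affineSegmentMap]
  have h2 : Set.projIcc (-1 : ℝ) 1 (by norm_num) 0 = ⟨0, by norm_num, by norm_num⟩ :=
    Set.projIcc_of_mem _ (by norm_num)
  change X.realizationHomeo.symm (DoubleCylinder.sweep _ _ (affineSegmentMap ((0, 0) : ℝ × ℝ) (1, 0) r)) = _
  rw [h1]
  change X.realizationHomeo.symm (DoubleCylinder.cyl _ (_, Set.projIcc (-1 : ℝ) 1 (by norm_num) 0)) = _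
  rw [h2]
  rfl

theorem mainTheorem5 (X : GraphOfSpaces.{u})
    (hlpc : ∀ v, LocallyPathConnectedSpace (X.vert v))
    (hslsc : ∀ v, SemilocallySimplyConnected (X.vert v))
    (hE : Finite X.E)
    (hcircle : ∀ e, Nonempty (X.edge e ≃ₜ Circle))
    (hH1 : ∀ e, IsInfiniteDirectFactor (singularH1Map (X.edgeIncl e)))
    (Y : GraphOfSpaces.{u}) (f : GraphOfSpaces.Hom Y X)
    (hf : f.IsPreCovering) (hfin : FiniteSheeted f.toMap)
    (hV : Nat.card X.V = 1 ∨ (Nat.card X.V = 2 ∧ ConnectedSpace Y.Realization)) :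
    ∃ (Xhat Xtilde : Type u) (_ : TopologicalSpace Xhat) (_ : TopologicalSpace Xtilde)
      (p : Xhat → Y.Realization) (q : Xtilde → X.Realization) (j : Xhat → Xtilde),
      IsFiniteSheetedCovering p ∧ IsFiniteSheetedCovering q ∧
        Topology.IsEmbedding j ∧ q ∘ j = f.toMap ∘ p := by
  -- With finitely many vertex spaces their coverings can be completed to one common degree.
  have : Finite X.V := Nat.finite_of_card_ne_zero (by omega)
  let fV : C(Σ v, Y.vert v, Σ v, X.vert v) :=
    ⟨Sigma.map f.onV fun v => f.vertMap v, Continuous.sigma_map fun v => (f.vertMap v).continuous⟩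
  let fE : C(Σ e, Y.edge e, Σ e, X.edge e) :=
    ⟨Sigma.map f.onE fun e => f.edgeMap e, Continuous.sigma_map fun e => (f.edgeMap e).continuous⟩
  have comm : ∀ s z, fV (Y.totalBd s z) = X.totalBd s (fE z) := fun s z => f.comm z.1 s z.2
  have hmap : ∀ z, DoubleCylinder.map fV fE comm (Y.realizationHomeo z) =
      X.realizationHomeo (f.toMap z) := by
    rintro ⟨v | ⟨e, x, t⟩⟩ <;> rfl
  have hmap' : DoubleCylinder.map fV fE comm =
      X.realizationHomeo ∘ f.toMap ∘ Y.realizationHomeo.symm := funext fun z => by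
    rw [Function.comp_apply, Function.comp_apply, ← hmap, Homeomorph.apply_symm_apply]
  have hloc : IsLocallyInjective (DoubleCylinder.map fV fE comm) := fun z => by
    obtain ⟨U, hU, hz, hinj⟩ := hf.locallyInjective (Y.realizationHomeo.symm z)
    refine ⟨_, hU.preimage Y.realizationHomeo.symm.continuous, hz, fun a ha b hb h => ?_⟩
    rw [hmap'] at h
    exact Y.realizationHomeo.symm.injective (hinj ha hb (X.realizationHomeo.injective h))
  have hfin' : FiniteSheeted (DoubleCylinder.map fV fE comm) := fun z => by
    refine ((hfin (X.realizationHomeo.symm z)).preimage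
      Y.realizationHomeo.symm.injective.injOn).subset fun w hw => ?_
    rw [hmap'] at hw
    exact (X.realizationHomeo.eq_symm_apply).2 hw
  have hfVfin := DoubleCylinder.finiteSheeted_of_map_vert hfin'
  have hfEfin := DoubleCylinder.finiteSheeted_of_map_cyl hfin'
  have hfV : IsCoveringMap fV := isCoveringMap_sigmaMap _ _ hf.vert_covering hfVfin
  have hfE : IsCoveringMap fE := isCoveringMap_sigmaMap _ _ hf.edge_covering hfEfin
  obtain ⟨n, W, _, g, j, hn, hg, hgcard, hj, hgj⟩ := hfV.exists_const_degree hfVfin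
  have : NeZero n.factorial := ⟨n.factorial_ne_zero⟩
  choose q hq using fun e => exists_isCircleCover (hcircle e).some
  -- The modulus is the factorial of the common degree, so that it annihilates the monodromy of `W`.
  choose c₀ hc₀ using fun e =>
    exists_pathCocycle_of_isInfiniteDirectFactor (X.edgeIncl e) (hq e) (hH1 e) n.factorial
  have : ∀ e, LocallyPathConnectedSpace (X.edge e) := fun e =>
    ((hq e).isCoveringMap.isQuotientMap (hq e).surjective).locallyPathConnectedSpace
  -- On the circle `e` the coordinate `e` takes the value 1, of order exactly `n!`, and `n!` kills
  -- all other coordinates; so the product has order exactly `n!` on every edge circle at once.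
  let c : PathCocycle (DoubleCylinder X.totalBd) (X.E → ZMod n.factorial) :=
    (PathCocycle.pi c₀).comap ⟨_, X.realizationHomeo.symm.continuous⟩
  have hc : (c.comap ⟨DoubleCylinder.vert X.totalBd, DoubleCylinder.continuous_vert⟩).LocallyTrivial :=
    PathCocycle.locallyTrivial_sigma _ fun v =>
      PathCocycle.locallyTrivial_of_semilocallySimplyConnected _ (hslsc v)
  obtain ⟨Xhat, Xtilde, _, _, p, r, J, hp, hr, hJ, hcomm⟩ :=
    DoubleCylinder.exists_finite_covering_extending fV fE comm hfE
      (DoubleCylinder.eq_of_isLocallyInjective hloc) (IsCircleCover.sigma hq) hg hn hgcard hj hgj c hc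
      (fun e s k => by
        have h := X.along_vert_realizationHomeo (PathCocycle.pi c₀) e
          (q := q e) (by simpa using (hq e).add_int 0 1) s
        rw [h]
        constructor
        · intro hk
          have hke : k • (c₀ e).along ((X.edgeIncl e).comp (q e)) 0 1 = 0 := congrFun hk e
          rw [hc₀, zsmul_one] at hke
          exact (ZMod.intCast_zmod_eq_zero_iff_dvd _ _).1 hke
        · intro hk
          funext e'
          rw [Pi.smul_apply, zsmul_eq_mul, (ZMod.intCast_zmod_eq_zero_iff_dvd _ _).2 hk, zero_mul]
          rfl)
  refine ⟨Xhat, Xtilde, inferInstance, inferInstance, Y.realizationHomeo.symm ∘ p,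
    X.realizationHomeo.symm ∘ r, J, ⟨hp.isCoveringMap.homeomorph_comp _,
      Y.realizationHomeo.symm.surjective.comp hp.surjective, fun b => ?_⟩,
    ⟨hr.isCoveringMap.homeomorph_comp _, X.realizationHomeo.symm.surjective.comp hr.surjective,
      fun b => ?_⟩, hJ, funext fun z => ?_⟩
  · refine (hp.finiteSheeted (Y.realizationHomeo b)).subset fun z hz => ?_
    exact (Y.realizationHomeo.symm_apply_eq).1 hz
  · refine (hr.finiteSheeted (X.realizationHomeo b)).subset fun z hz => ?_
    exact (X.realizationHomeo.symm_apply_eq).1 hz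
  · have h := congrFun hcomm z
    rw [Function.comp_apply, Function.comp_apply, hmap'] at h
    exact (X.realizationHomeo.symm_apply_eq).2 h
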